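/- Let $a\ge b\ge -\tfrac12$ with $a\ge 0$. Put $w(x)=x^a(1-x)^b$ on $(0,1)$ and let $P_0,P_1,P_2,\dots$ be the orthonormal Jacobi polynomials on $[0,1]$, that is, $P_j$ is a real polynomial of degree $j$ and $$\int_0^1 P_j(x)P_k(x)\,w(x)\,dx=\delta_{jk}\qquad (j,k\ge 0).$$ Let $$K_N^{(a,b)}(x,y)=\sqrt{w(x)w(y)}\,\sum_{j=0}^{N-1}P_j(x)P_j(y)$$ be the correlation kernel of the $N$-point Jacobi ensemble. Then for every $N$ the function $x^{-1/2}(1-x)^{1/2}K_N^{(a,b)}(x,x)$ is integrable on $[0,1]$, and $$\int_0^1 x^{-1/2}(1-x)^{1/2}K_N^{(a,b)}(x,x)\,dx\;\sim\;\frac{2}{\pi}\,N\log N\qquad (N\to\infty),$$ that is, the ratio of the two sides tends to $1$. The same two assertions hold if the sum in $K_N^{(a,b)}$ is taken over $j=1,\dots,N$ instead of $j=0,\dots,N-1$. -/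

import Mathlib

noncomputable section
open Polynomial

/-- The Jacobi weight `w(x) = x ^ a * (1 - x) ^ b` on `(0, 1)`. -/
def jacobiWeight (a b x : ℝ) : ℝ := x ^ a * (1 - x) ^ b

/-- The pairing of polynomials `⟨p, q⟩ = ∫₀¹ p(x) q(x) w(x) dx`. -/
def jacobiInner (a b : ℝ) (p q : ℝ[X]) : ℝ :=
  ∫ x in (0 : ℝ)..1, p.eval x * q.eval x * jacobiWeight a b x

/-- The monic orthogonal polynomials for the Jacobi weight on `[0, 1]`, obtained from
`1, X, X ^ 2, …` by the Gram–Schmidt process; the `n`-th one has degree `n`. -/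
def jacobiMonic (a b : ℝ) (n : ℕ) : ℝ[X] :=
  X ^ n - ∑ k : Fin n,
    C (jacobiInner a b (X ^ n) (jacobiMonic a b k) /
      jacobiInner a b (jacobiMonic a b k) (jacobiMonic a b k)) * jacobiMonic a b k
termination_by n
decreasing_by exact k.2

/-- The orthonormal Jacobi polynomials on `[0, 1]`, indexed by their degree. -/
def jacobiP (a b : ℝ) (n : ℕ) : ℝ[X] :=
  C (√(jacobiInner a b (jacobiMonic a b n) (jacobiMonic a b n)))⁻¹ * jacobiMonic a b n

theorem jacobiMonic_eq (a b : ℝ) (n : ℕ) : jacobiMonic a b n =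
    X ^ n - ∑ k : Fin n, C (jacobiInner a b (X ^ n) (jacobiMonic a b k) /
      jacobiInner a b (jacobiMonic a b k) (jacobiMonic a b k)) * jacobiMonic a b k := by
  rw [jacobiMonic]

theorem jacobiMonic_monic_degree (a b : ℝ) (n : ℕ) :
    (jacobiMonic a b n).Monic ∧ (jacobiMonic a b n).degree = n := by
  induction n using Nat.strong_induction_on with
  | _ n ih =>
    have hlt : (∑ k : Fin n, C (jacobiInner a b (X ^ n) (jacobiMonic a b k) /
        jacobiInner a b (jacobiMonic a b k) (jacobiMonic a b k)) * jacobiMonic a b k).degree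
        < (X ^ n : ℝ[X]).degree := by
      rw [degree_X_pow]
      refine (degree_sum_le _ _).trans_lt ?_
      refine (Finset.sup_lt_iff (WithBot.bot_lt_coe n)).2 ?_
      intro k _
      rw [← smul_eq_C_mul]
      refine (degree_smul_le _ _).trans_lt ?_
      rw [(ih k k.2).2]
      exact Nat.cast_lt.2 k.2
    rw [jacobiMonic_eq]
    exact ⟨(monic_X_pow n).sub_of_left hlt, by rw [degree_sub_eq_left_of_degree_lt hlt, degree_X_pow]⟩

theorem intervalIntegrable_jacobiWeight {a b : ℝ} (ha : -1 < a) (hb : -1 < b) :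
    IntervalIntegrable (jacobiWeight a b) MeasureTheory.volume 0 1 := by
  have h := (Complex.betaIntegral_convergent (u := (a : ℂ) + 1) (v := (b : ℂ) + 1)
    (by simp; linarith) (by simp; linarith)).norm
  refine h.congr_ae ?_
  rw [Filter.EventuallyEq, MeasureTheory.ae_restrict_iff' measurableSet_uIoc]
  have h1 : ∀ᵐ x : ℝ, x ≠ 1 := by simp [MeasureTheory.ae_iff]
  filter_upwards [h1] with x hx1 hx
  rw [Set.uIoc_of_le zero_le_one] at hx
  have hx0 : 0 < x := hx.1
  have hx2 : 0 < 1 - x := by have := lt_of_le_of_ne hx.2 hx1; linarith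
  have e : (1 - (x : ℂ)) = ((1 - x : ℝ) : ℂ) := by push_cast; rfl
  rw [norm_mul, e, Complex.norm_cpow_eq_rpow_re_of_pos hx0,
    Complex.norm_cpow_eq_rpow_re_of_pos hx2]
  simp [jacobiWeight]

theorem intervalIntegrable_eval_mul_jacobiWeight {a b : ℝ} (ha : -1 < a) (hb : -1 < b)
    (p q : ℝ[X]) : IntervalIntegrable (fun x => p.eval x * q.eval x * jacobiWeight a b x)
      MeasureTheory.volume 0 1 :=
  (intervalIntegrable_jacobiWeight ha hb).continuousOn_mul
    (p.continuous.mul q.continuous).continuousOn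

theorem jacobiInner_comm (a b : ℝ) (p q : ℝ[X]) : jacobiInner a b p q = jacobiInner a b q p := by
  simp only [jacobiInner, mul_comm (p.eval _)]

theorem jacobiInner_C_mul (a b c : ℝ) (p q : ℝ[X]) :
    jacobiInner a b (C c * p) q = c * jacobiInner a b p q := by
  simp only [jacobiInner, ← intervalIntegral.integral_const_mul, eval_mul, eval_C, mul_assoc]

theorem jacobiInner_sub {a b : ℝ} (ha : -1 < a) (hb : -1 < b) (p q r : ℝ[X]) :
    jacobiInner a b (p - q) r = jacobiInner a b p r - jacobiInner a b q r := by
  simp only [jacobiInner, eval_sub, sub_mul]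
  exact intervalIntegral.integral_sub (intervalIntegrable_eval_mul_jacobiWeight ha hb _ _)
    (intervalIntegrable_eval_mul_jacobiWeight ha hb _ _)

theorem jacobiInner_sum {a b : ℝ} (ha : -1 < a) (hb : -1 < b) {ι : Type*} (s : Finset ι)
    (f : ι → ℝ[X]) (r : ℝ[X]) :
    jacobiInner a b (∑ i ∈ s, f i) r = ∑ i ∈ s, jacobiInner a b (f i) r := by
  simp only [jacobiInner, eval_finsetSum, Finset.sum_mul]
  exact intervalIntegral.integral_finsetSum fun i _ =>
    intervalIntegrable_eval_mul_jacobiWeight ha hb _ _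

theorem jacobiInner_self_pos {a b : ℝ} (ha : -1 < a) (hb : -1 < b) {p : ℝ[X]} (hp : p ≠ 0) :
    0 < jacobiInner a b p p := by
  have hint := intervalIntegrable_eval_mul_jacobiWeight ha hb p p
  have hnn : 0 ≤ᵐ[MeasureTheory.volume.restrict (Set.uIoc (0 : ℝ) 1)]
      fun x => p.eval x * p.eval x * jacobiWeight a b x := by
    rw [Filter.EventuallyLE, MeasureTheory.ae_restrict_iff' measurableSet_uIoc]
    refine Filter.Eventually.of_forall fun x hx => ?_
    rw [Set.uIoc_of_le zero_le_one] at hx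
    exact mul_nonneg (mul_self_nonneg _)
      (mul_nonneg (Real.rpow_nonneg hx.1.le _) (Real.rpow_nonneg (by linarith [hx.2]) _))
  rw [jacobiInner, intervalIntegral.integral_pos_iff_support_of_nonneg_ae' hnn hint]
  refine ⟨zero_lt_one, ?_⟩
  have hsub : Set.Ioo (0 : ℝ) 1 \ (p.roots.toFinset : Set ℝ) ⊆
      Function.support (fun x => p.eval x * p.eval x * jacobiWeight a b x) ∩ Set.Ioc 0 1 := by
    rintro x ⟨⟨h0, h1⟩, hx⟩
    have hx' : p.eval x ≠ 0 := by simpa [hp] using hx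
    refine ⟨mul_ne_zero (mul_ne_zero hx' hx') (mul_pos (Real.rpow_pos_of_pos h0 _)
      (Real.rpow_pos_of_pos (by linarith) _)).ne', h0, h1.le⟩
  refine lt_of_lt_of_le ?_ (MeasureTheory.measure_mono hsub)
  rw [MeasureTheory.measure_sdiff_null ((Finset.finite_toSet _).measure_zero _)]
  simp

theorem jacobiMonic_orthogonal {a b : ℝ} (ha : -1 < a) (hb : -1 < b) (n : ℕ) :
    ∀ k < n, jacobiInner a b (jacobiMonic a b n) (jacobiMonic a b k) = 0 := by
  induction n using Nat.strong_induction_on with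
  | _ n ih =>
    intro k hk
    rw [jacobiMonic_eq a b n, jacobiInner_sub ha hb, jacobiInner_sum ha hb,
      Finset.sum_eq_single (⟨k, hk⟩ : Fin n)]
    · rw [jacobiInner_C_mul, div_mul_cancel₀, sub_self]
      exact (jacobiInner_self_pos ha hb (jacobiMonic_monic_degree a b k).1.ne_zero).ne'
    · intro j _ hj
      have hjk : (j : ℕ) ≠ k := fun h => hj (Fin.ext h)
      rw [jacobiInner_C_mul]
      rcases lt_or_gt_of_ne hjk with h | h
      · rw [jacobiInner_comm a b (jacobiMonic a b j) (jacobiMonic a b k), ih k hk j h, mul_zero]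
      · rw [ih j j.2 k h, mul_zero]
    · simp

/-- `jacobiP a b n` has degree `n`. -/
theorem degree_jacobiP {a b : ℝ} (ha : -1 < a) (hb : -1 < b) (n : ℕ) :
    (jacobiP a b n).degree = n := by
  obtain ⟨hm, hd⟩ := jacobiMonic_monic_degree a b n
  rw [jacobiP, degree_C_mul, hd]
  exact inv_ne_zero (Real.sqrt_pos.2 (jacobiInner_self_pos ha hb hm.ne_zero)).ne'

/-- The orthonormality relation `∫₀¹ P_j P_k w = δ_{jk}`. -/
theorem jacobiP_orthonormal {a b : ℝ} (ha : -1 < a) (hb : -1 < b) (j k : ℕ) :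
    ∫ x in (0 : ℝ)..1, (jacobiP a b j).eval x * (jacobiP a b k).eval x * jacobiWeight a b x =
      if j = k then 1 else 0 := by
  change jacobiInner a b (jacobiP a b j) (jacobiP a b k) = _
  rw [jacobiP, jacobiP, jacobiInner_C_mul, jacobiInner_comm a b (jacobiMonic a b j) (C _ * _),
    jacobiInner_C_mul]
  split_ifs with h
  · subst h
    have hpos := jacobiInner_self_pos ha hb (jacobiMonic_monic_degree a b j).1.ne_zero
    have hs := Real.mul_self_sqrt hpos.le
    have hs' := (Real.sqrt_pos.2 hpos).ne'
    field_simp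
    rw [sq, hs]
  · rcases lt_or_gt_of_ne h with h | h
    · rw [jacobiMonic_orthogonal ha hb k j h]; simp
    · rw [jacobiInner_comm a b (jacobiMonic a b k) (jacobiMonic a b j),
        jacobiMonic_orthogonal ha hb j k h]; simp

/-- The kernel `√(w(x) w(y)) ∑_{j ∈ s} P_j(x) P_j(y)` built from the orthonormal Jacobi polynomials
with degrees in `s`. For `s = {0, …, N - 1}` it is the correlation kernel of the `N`-point Jacobi
ensemble. -/
def jacobiKernel (a b : ℝ) (s : Finset ℕ) (x y : ℝ) : ℝ :=
  √(jacobiWeight a b x * jacobiWeight a b y) *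
    ∑ j ∈ s, (jacobiP a b j).eval x * (jacobiP a b j).eval y

end

open Polynomial Real Filter Topology Asymptotics

/-! On the diagonal the kernel is `w` times a sum of squares, so the integral is the sum of the
masses `d_j = ∫ P_j² x^(a-1/2) (1-x)^(b+1/2)`. It suffices to show `d_n = (2/π) log n + o(log n)`
and to sum over `n`.

Put `x = sin² t` and `u = sin^(a+1/2) cos^(b+1/2) P_n(sin² t)`. Jacobi's equation becomes `u'' + (L²
+ V) u = 0` with `L = 2n+a+b+1` and `V = O(t⁻²)` near `0`; normalization reads `2 ∫ u² = 1`, and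
`d_n = 2 ∫ cot t · u²`. The energy `E = u'² + L² u²` satisfies `E' = -2 V u u'`, so a Gronwall
argument gives `E(t) = E(π/4) (1 + O(1/(L t)))` for `L t ≥ κ` and `t ≤ π/4`
(`exists_abs_jacobiEnergy_sub_le`). Since `2 L² u² = E - V u² - (u u')'`, the density `u²` averages
to `E(π/4)/(2 L²)` (`exists_abs_integral_mul_jacobiU_sq_sub_le`). The piece `[0, κ/L]` is negligible
because `P_n` is controlled there by its value at the right end (`exists_jacobiU_sq_le`).

With weight `1` on both halves of `[0, π/2]`, the normalization forces `E(π/4)/L² → 2/π`. With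
weight `cot` the half near `0` gives `E(π/4)/L² · (log L + O(1))`, and the other half is bounded
(`exists_jacobiInner_shift_estimate`). The logarithm is that of `∫ dt/t` from `κ/L`. -/

/-! ### The Jacobi operator, its symmetry, and the differential equation of the orthogonal
polynomials. -/

/-- The Jacobi differential operator `x (1 - x) p'' + (a + 1 - (a + b + 2) x) p'`. -/
noncomputable def jacobiOp (a b : ℝ) (p : ℝ[X]) : ℝ[X] :=
  X * (1 - X) * derivative (derivative p) + (C (a + 1) - C (a + b + 2) * X) * derivative p

/-- On monomials the operator is triangular, with diagonal entries `-k (k+a+b+1)`: degrees do not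
grow, and the eigenvalues can be read off. -/
theorem coeff_jacobiOp (a b : ℝ) (p : ℝ[X]) (k : ℕ) :
    (jacobiOp a b p).coeff k =
      (k + 1) * (k + a + 1) * p.coeff (k + 1) - k * (k + a + b + 1) * p.coeff k := by
  have h : jacobiOp a b p = derivative (derivative p) * X - derivative (derivative p) * X * X
      + (C (a + 1) * derivative p - C (a + b + 2) * (derivative p * X)) := by
    rw [jacobiOp]; ring
  rw [h]
  simp only [coeff_add, coeff_sub, coeff_C_mul]
  rcases k with _ | _ | k <;> simp [coeff_derivative] <;> ring

theorem degree_jacobiOp_lt {a b : ℝ} {p : ℝ[X]} {n : ℕ} (hp : p.degree < n) :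
    (jacobiOp a b p).degree < n := by
  rw [degree_lt_iff_coeff_zero] at hp ⊢
  intro m hm
  rw [coeff_jacobiOp, hp m hm, hp (m + 1) (by omega)]
  ring

theorem eval_jacobiOp (a b : ℝ) (p : ℝ[X]) (x : ℝ) :
    (jacobiOp a b p).eval x = x * (1 - x) * (derivative (derivative p)).eval x +
      (a + 1 - (a + b + 2) * x) * (derivative p).eval x := by
  simp [jacobiOp]

theorem hasDerivAt_rpow_mul_one_sub_rpow (a b : ℝ) {x : ℝ} (h0 : 0 < x) (h1 : x < 1) :
    HasDerivAt (fun x : ℝ => x ^ (a + 1) * (1 - x) ^ (b + 1))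
      ((a + 1 - (a + b + 2) * x) * jacobiWeight a b x) x := by
  have h2 : 0 < 1 - x := by linarith
  have e1 := Real.hasDerivAt_rpow_const (x := x) (p := a + 1) (Or.inl h0.ne')
  have e2 := ((hasDerivAt_id x).const_sub 1).rpow_const (p := b + 1) (Or.inl h2.ne')
  refine (e1.mul e2).congr_deriv ?_
  simp only [jacobiWeight, id, add_sub_cancel_right, Real.rpow_add h0, Real.rpow_add h2,
    Real.rpow_one]
  ring

/-- Lagrange's identity: the difference of the integrands is the derivative of `x^(a+1) (1-x)^(b+1)
(p' q - p q')`, which vanishes at both ends because `a + 1` and `b + 1` are positive. -/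
theorem jacobiInner_jacobiOp_comm {a b : ℝ} (ha : -1 < a) (hb : -1 < b) (p q : ℝ[X]) :
    jacobiInner a b (jacobiOp a b p) q = jacobiInner a b p (jacobiOp a b q) := by
  have hi1 := intervalIntegrable_eval_mul_jacobiWeight ha hb (jacobiOp a b p) q
  have hi2 := intervalIntegrable_eval_mul_jacobiWeight ha hb p (jacobiOp a b q)
  rw [← sub_eq_zero, jacobiInner, jacobiInner, ← intervalIntegral.integral_sub hi1 hi2]
  rw [intervalIntegral.integral_eq_sub_of_hasDerivAt_of_le zero_le_one
    (f := fun x => x ^ (a + 1) * (1 - x) ^ (b + 1) *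
      ((derivative p).eval x * q.eval x - p.eval x * (derivative q).eval x)) _ _ (hi1.sub hi2)]
  · simp [Real.zero_rpow (show a + 1 ≠ 0 by linarith), Real.zero_rpow (show b + 1 ≠ 0 by linarith)]
  · refine ContinuousOn.mul (ContinuousOn.mul ?_ ?_) ?_
    · exact (Real.continuous_rpow_const (by linarith)).continuousOn
    · exact ((Real.continuous_rpow_const (by linarith)).comp (by fun_prop)).continuousOn
    · fun_prop
  · rintro x ⟨h0, h1⟩
    have h2 : 0 < 1 - x := by linarith
    have e := (hasDerivAt_rpow_mul_one_sub_rpow a b h0 h1).mul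
      ((((derivative p).hasDerivAt x).mul (q.hasDerivAt x)).sub
        ((p.hasDerivAt x).mul ((derivative q).hasDerivAt x)))
    refine e.congr_deriv ?_
    simp only [eval_jacobiOp, jacobiWeight, Real.rpow_add h0, Real.rpow_add h2, Real.rpow_one,
      Pi.mul_apply, Pi.sub_apply]
    ring

theorem jacobiInner_jacobiMonic_of_degree_lt {a b : ℝ} (ha : -1 < a) (hb : -1 < b) {n d : ℕ}
    (hd : d ≤ n) {q : ℝ[X]} (hq : q.degree < d) : jacobiInner a b q (jacobiMonic a b n) = 0 := by
  induction d generalizing q with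
  | zero =>
    have : q = 0 := by simpa using hq
    simp [this, jacobiInner]
  | succ d ih =>
    obtain ⟨hm, hdeg⟩ := jacobiMonic_monic_degree a b d
    have h1 : (q - C (q.coeff d) * jacobiMonic a b d).degree < d := by
      rw [degree_lt_iff_coeff_zero] at hq ⊢
      intro m hmd
      rcases hmd.eq_or_lt with rfl | hlt
      · have : (jacobiMonic a b d).coeff d = 1 := by
          have := hm.coeff_natDegree
          rwa [natDegree_eq_of_degree_eq_some hdeg] at this
        simp [this]
      · rw [coeff_sub, coeff_C_mul, hq m hlt,
          coeff_eq_zero_of_degree_lt (p := jacobiMonic a b d) (by rw [hdeg]; exact_mod_cast hlt)]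
        simp
    have h2 := ih (by omega) h1
    rw [jacobiInner_sub ha hb, jacobiInner_C_mul,
      jacobiInner_comm a b (jacobiMonic a b d), jacobiMonic_orthogonal ha hb n d (by omega)] at h2
    simpa using h2

/-- The Jacobi differential equation on `[0, 1]` with parameters `a`, `b` and degree `m`. -/
def JacobiODE (a b m : ℝ) (p : ℝ[X]) : Prop :=
  ∀ x, x * (1 - x) * (derivative (derivative p)).eval x +
    (a + 1 - (a + b + 2) * x) * (derivative p).eval x + m * (m + a + b + 1) * p.eval x = 0

/-- The residual `r` of the eigenvalue equation loses its leading term, so it has degree below `n`.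
By symmetry `⟨r, r⟩` reduces to pairings of `p` with polynomials of degree below `n`, hence
vanishes. -/
theorem jacobiODE_jacobiMonic {a b : ℝ} (ha : -1 < a) (hb : -1 < b) (n : ℕ) :
    JacobiODE a b n (jacobiMonic a b n) := by
  obtain ⟨hm, hdeg⟩ := jacobiMonic_monic_degree a b n
  set p := jacobiMonic a b n with hp
  set r : ℝ[X] := jacobiOp a b p - C (-(n * (n + a + b + 1)) : ℝ) * p with hr
  have hrdeg : r.degree < n := by
    have h0 : ∀ m, n < m → p.coeff m = 0 := fun m hm =>
      coeff_eq_zero_of_degree_lt (by rw [hdeg]; exact_mod_cast hm)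
    rw [degree_lt_iff_coeff_zero]
    intro m hmn
    rw [hr, coeff_sub, coeff_C_mul, coeff_jacobiOp, h0 (m + 1) (by omega)]
    rcases hmn.eq_or_lt with rfl | hlt
    · ring
    · rw [h0 m hlt]; ring
  have hrr : jacobiInner a b r r = 0 := by
    nth_rw 1 [hr]
    rw [jacobiInner_sub ha hb, jacobiInner_C_mul, jacobiInner_jacobiOp_comm ha hb,
      jacobiInner_comm a b p, jacobiInner_comm a b p,
      jacobiInner_jacobiMonic_of_degree_lt ha hb le_rfl (degree_jacobiOp_lt hrdeg),
      jacobiInner_jacobiMonic_of_degree_lt ha hb le_rfl hrdeg]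
    simp
  have hr0 : r = 0 := by
    by_contra h
    exact (jacobiInner_self_pos ha hb h).ne' hrr
  intro x
  have := congrArg (eval x) hr0
  simp only [hr, eval_sub, eval_mul, eval_C, eval_jacobiOp, eval_zero] at this
  linarith

theorem jacobiODE_jacobiP {a b : ℝ} (ha : -1 < a) (hb : -1 < b) (n : ℕ) :
    JacobiODE a b n (jacobiP a b n) := by
  intro x
  have := jacobiODE_jacobiMonic ha hb n x
  simp only [jacobiP, derivative_C_mul, eval_mul, eval_C]
  linear_combination (√(jacobiInner a b (jacobiMonic a b n) (jacobiMonic a b n)))⁻¹ * this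

/-- Reflection swaps `a` and `b`, so estimates near `t = 0` also serve near `t = π/2`. -/
theorem JacobiODE.comp_one_sub {a b m : ℝ} {p : ℝ[X]} (h : JacobiODE a b m p) :
    JacobiODE b a m (p.comp (1 - X)) := by
  intro x
  have := h (1 - x)
  simp [derivative_comp]
  linear_combination this

/-! ### Liouville normal form and energy. -/

/-- The Liouville transform `sin ^ (a + 1/2) * cos ^ (b + 1/2) * p (sin ^ 2)` of `p`. -/
noncomputable def jacobiU (a b : ℝ) (p : ℝ[X]) (t : ℝ) : ℝ :=
  sin t ^ (a + 1 / 2) * cos t ^ (b + 1 / 2) * p.eval (sin t ^ 2)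

/-- The derivative of `jacobiU a b p` on `(0, π / 2)`. -/
noncomputable def jacobiUDeriv (a b : ℝ) (p : ℝ[X]) (t : ℝ) : ℝ :=
  sin t ^ (a + 1 / 2) * cos t ^ (b + 1 / 2) *
    (((a + 1 / 2) * (cos t / sin t) - (b + 1 / 2) * (sin t / cos t)) * p.eval (sin t ^ 2) +
      2 * sin t * cos t * (derivative p).eval (sin t ^ 2))

/-- The potential in the differential equation satisfied by `jacobiU a b p`. -/
noncomputable def jacobiV (a b t : ℝ) : ℝ :=
  (1 / 4 - a ^ 2) / sin t ^ 2 + (1 / 4 - b ^ 2) / cos t ^ 2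

/-- The energy `u' ^ 2 + L ^ 2 * u ^ 2` of `u = jacobiU a b p`. -/
noncomputable def jacobiEnergy (a b L : ℝ) (p : ℝ[X]) (t : ℝ) : ℝ :=
  jacobiUDeriv a b p t ^ 2 + L ^ 2 * jacobiU a b p t ^ 2


theorem hasDerivAt_sin_rpow_mul_cos_rpow (α β : ℝ) {t : ℝ} (hs : 0 < sin t) (hc : 0 < cos t) :
    HasDerivAt (fun t => sin t ^ α * cos t ^ β)
      (sin t ^ α * cos t ^ β * (α * (cos t / sin t) - β * (sin t / cos t))) t := by
  have e1 := (hasDerivAt_sin t).rpow_const (p := α) (Or.inl hs.ne')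
  have e2 := (hasDerivAt_cos t).rpow_const (p := β) (Or.inl hc.ne')
  refine (e1.mul e2).congr_deriv ?_
  rw [rpow_sub_one hs.ne', rpow_sub_one hc.ne']
  field_simp
  ring

theorem hasDerivAt_eval_sin_sq (p : ℝ[X]) (t : ℝ) :
    HasDerivAt (fun t => p.eval (sin t ^ 2))
      (2 * sin t * cos t * (derivative p).eval (sin t ^ 2)) t := by
  have e := (p.hasDerivAt (sin t ^ 2)).comp t ((hasDerivAt_sin t).pow 2)
  refine e.congr_deriv ?_
  norm_num
  ring

theorem hasDerivAt_jacobiU (a b : ℝ) (p : ℝ[X]) {t : ℝ} (hs : 0 < sin t) (hc : 0 < cos t) :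
    HasDerivAt (jacobiU a b p) (jacobiUDeriv a b p t) t := by
  refine ((hasDerivAt_sin_rpow_mul_cos_rpow (a + 1 / 2) (b + 1 / 2) hs hc).mul
    (hasDerivAt_eval_sin_sq p t)).congr_deriv ?_
  rw [jacobiUDeriv]
  ring

theorem hasDerivAt_jacobiUDeriv {a b m : ℝ} {p : ℝ[X]} (h : JacobiODE a b m p) {t : ℝ}
    (hs : 0 < sin t) (hc : 0 < cos t) :
    HasDerivAt (jacobiUDeriv a b p)
      (-((2 * m + a + b + 1) ^ 2 + jacobiV a b t) * jacobiU a b p t) t := by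
  have e1 := hasDerivAt_sin_rpow_mul_cos_rpow (a + 1 / 2) (b + 1 / 2) hs hc
  have e2 := ((((hasDerivAt_cos t).div (hasDerivAt_sin t) hs.ne').const_mul (a + 1 / 2)).sub
    (((hasDerivAt_sin t).div (hasDerivAt_cos t) hc.ne').const_mul (b + 1 / 2))).mul
      (hasDerivAt_eval_sin_sq p t)
  have e3 := ((((hasDerivAt_sin t).const_mul 2).mul (hasDerivAt_cos t))).mul
    (hasDerivAt_eval_sin_sq (derivative p) t)
  refine (e1.mul (e2.add e3)).congr_deriv ?_
  simp only [jacobiU, jacobiV, Pi.add_apply, Pi.sub_apply, Pi.mul_apply, Pi.div_apply]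
  have hode := h (sin t ^ 2)
  have hc2 : cos t ^ 2 = 1 - sin t ^ 2 := by have := sin_sq_add_cos_sq t; linarith
  generalize hG : sin t ^ (a + 1 / 2) * cos t ^ (b + 1 / 2) = G
  rw [← hc2] at hode
  generalize (derivative (derivative p)).eval (sin t ^ 2) = y2 at *
  generalize (derivative p).eval (sin t ^ 2) = y1 at *
  generalize p.eval (sin t ^ 2) = y0 at *
  generalize hS : sin t = s at *
  generalize hC : cos t = c at *
  have hcc : c ^ 2 + s ^ 2 = 1 := by linarith
  have key : G * (4 * s ^ 2 * c ^ 2 * y2 + (4 * ((a + 1) - (a + b + 2) * s ^ 2)) * y1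
      + 4 * m * (m + a + b + 1) * y0) = 0 := by
    linear_combination 4 * G * hode
  -- With `q` the logarithmic derivative of the prefactor, `h0` says `q² + q' + L² + V = 4 m
  -- (m+a+b+1)`, the coefficient of `p`; `h1` serves the coefficient of `p'`.
  have h0 : ((a + 1 / 2) * (c / s) - (b + 1 / 2) * (s / c)) ^ 2 +
      ((a + 1 / 2) * ((-s * s - c * c) / s ^ 2) - (b + 1 / 2) * ((c * c - s * -s) / c ^ 2)) +
      ((2 * m + a + b + 1) ^ 2 + ((1 / 4 - a ^ 2) / s ^ 2 + (1 / 4 - b ^ 2) / c ^ 2)) -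
      4 * (m * (m + a + b + 1)) = 0 := by
    field_simp
    linear_combination 16 * ((a ^ 2 - 1 / 4) * c ^ 2 + (b ^ 2 - 1 / 4) * s ^ 2) * hcc
  have h1 : ((a + 1 / 2) * (c / s) - (b + 1 / 2) * (s / c)) * (s * c) =
      (a + 1 / 2) * c ^ 2 - (b + 1 / 2) * s ^ 2 := by
    field_simp
  linear_combination G * y0 * h0 + 4 * G * y1 * h1 + key + 4 * (a + 1) * G * y1 * hcc

theorem jacobiU_comp_one_sub (a b : ℝ) (p : ℝ[X]) (t : ℝ) :
    jacobiU b a (p.comp (1 - X)) t = jacobiU a b p (π / 2 - t) := by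
  have : 1 - sin t ^ 2 = cos t ^ 2 := by have := sin_sq_add_cos_sq t; linarith
  simp only [jacobiU, sin_pi_div_two_sub, cos_pi_div_two_sub, eval_comp, eval_sub, eval_one, eval_X,
    this]
  ring

theorem jacobiUDeriv_comp_one_sub (a b : ℝ) (p : ℝ[X]) (t : ℝ) :
    jacobiUDeriv b a (p.comp (1 - X)) t = -jacobiUDeriv a b p (π / 2 - t) := by
  have : 1 - sin t ^ 2 = cos t ^ 2 := by have := sin_sq_add_cos_sq t; linarith
  simp only [jacobiUDeriv, sin_pi_div_two_sub, cos_pi_div_two_sub, eval_comp, eval_sub, eval_one,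
    eval_X, this, derivative_comp, derivative_sub, derivative_one, derivative_X, eval_mul, eval_zero]
  ring

theorem jacobiEnergy_comp_one_sub (a b L : ℝ) (p : ℝ[X]) (t : ℝ) :
    jacobiEnergy b a L (p.comp (1 - X)) t = jacobiEnergy a b L p (π / 2 - t) := by
  rw [jacobiEnergy, jacobiEnergy, jacobiU_comp_one_sub, jacobiUDeriv_comp_one_sub, neg_sq]

theorem jacobiEnergy_nonneg (a b L : ℝ) (p : ℝ[X]) (t : ℝ) : 0 ≤ jacobiEnergy a b L p t := by
  rw [jacobiEnergy]; positivity

theorem sq_mul_jacobiU_sq_le (a b L : ℝ) (p : ℝ[X]) (t : ℝ) :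
    L ^ 2 * jacobiU a b p t ^ 2 ≤ jacobiEnergy a b L p t := by
  rw [jacobiEnergy]; nlinarith [sq_nonneg (jacobiUDeriv a b p t)]

theorem two_mul_abs_jacobiU_mul_le (a b L : ℝ) (p : ℝ[X]) (t : ℝ) :
    2 * L * |jacobiU a b p t * jacobiUDeriv a b p t| ≤ jacobiEnergy a b L p t := by
  rw [jacobiEnergy, abs_mul]
  nlinarith [sq_nonneg (|jacobiUDeriv a b p t| - L * |jacobiU a b p t|),
    sq_abs (jacobiUDeriv a b p t), sq_abs (jacobiU a b p t)]

/-- The `L²` terms of `2 u' u''` and `2 L² u u'` cancel; only the potential moves the energy. -/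
theorem hasDerivAt_jacobiEnergy {a b m : ℝ} {p : ℝ[X]} (h : JacobiODE a b m p) {t : ℝ}
    (hs : 0 < sin t) (hc : 0 < cos t) :
    HasDerivAt (jacobiEnergy a b (2 * m + a + b + 1) p)
      (-2 * jacobiV a b t * (jacobiU a b p t * jacobiUDeriv a b p t)) t := by
  refine (((hasDerivAt_jacobiUDeriv h hs hc).pow 2).add
    (((hasDerivAt_jacobiU a b p hs hc).pow 2).const_mul _)).congr_deriv ?_
  norm_num
  ring

/-! ### Near constancy of the energy. -/

theorem sin_pos_and_cos_pos {t : ℝ} (h0 : 0 < t) (h1 : t < π / 2) : 0 < sin t ∧ 0 < cos t :=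
  ⟨sin_pos_of_pos_of_lt_pi h0 (by linarith [pi_pos]), cos_pos_of_mem_Ioo ⟨by linarith, h1⟩⟩

theorem half_le_sin {t : ℝ} (h0 : 0 ≤ t) (h1 : t ≤ π / 4) : t / 2 ≤ sin t := by
  have h := mul_le_sin h0 (by linarith [pi_pos])
  have : (1 : ℝ) / 2 ≤ 2 / π := by
    rw [div_le_div_iff₀ two_pos pi_pos]; linarith [pi_le_four]
  nlinarith

theorem half_le_cos_sq {t : ℝ} (h0 : 0 ≤ t) (h1 : t ≤ π / 4) : 1 / 2 ≤ cos t ^ 2 := by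
  have h2 : √2 / 2 ≤ cos t := by
    rw [← cos_pi_div_four]
    exact cos_le_cos_of_nonneg_of_le_pi h0 (by linarith [pi_pos]) h1
  have h3 : (√2) ^ 2 = 2 := sq_sqrt (by norm_num)
  nlinarith [sqrt_nonneg 2]

/-- A constant `D` with `|jacobiV a b t| ≤ D / t ^ 2` on `(0, π / 4]`. -/
theorem exists_abs_jacobiV_le (a b : ℝ) :
    ∃ D > 0, ∀ t, 0 < t → t ≤ π / 4 → |jacobiV a b t| ≤ D / t ^ 2 := by
  refine ⟨4 * |1 / 4 - a ^ 2| + 2 * |1 / 4 - b ^ 2| + 1, by positivity, fun t h0 h1 => ?_⟩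
  have hs := half_le_sin h0.le h1
  have hc := half_le_cos_sq h0.le h1
  have ht1 : t ≤ 1 := by linarith [pi_le_four]
  have hs2 : t ^ 2 / 4 ≤ sin t ^ 2 := by nlinarith
  have hc2 : t ^ 2 / 2 ≤ cos t ^ 2 := by nlinarith
  have ht2 : 0 < t ^ 2 := by positivity
  have e1 : |(1 / 4 - a ^ 2) / sin t ^ 2| ≤ 4 * |1 / 4 - a ^ 2| / t ^ 2 := by
    rw [abs_div, abs_of_nonneg (sq_nonneg (sin t)), div_le_div_iff₀ (by linarith) ht2]
    nlinarith [abs_nonneg (1 / 4 - a ^ 2)]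
  have e2 : |(1 / 4 - b ^ 2) / cos t ^ 2| ≤ 2 * |1 / 4 - b ^ 2| / t ^ 2 := by
    rw [abs_div, abs_of_nonneg (sq_nonneg (cos t)), div_le_div_iff₀ (by linarith) ht2]
    nlinarith [abs_nonneg (1 / 4 - b ^ 2)]
  have e3 : 0 ≤ 1 / t ^ 2 := by positivity
  calc |jacobiV a b t| ≤ _ := abs_add_le _ _
    _ ≤ 4 * |1 / 4 - a ^ 2| / t ^ 2 + 2 * |1 / 4 - b ^ 2| / t ^ 2 + 1 / t ^ 2 := by linarith
    _ = _ := by ring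

/-- Gronwall: `2 L |u u'| ≤ E` gives `|E'| ≤ E · D/(L t²)`, so `E exp(-D/(L t))` increases and `E
exp(D/(L t))` decreases. The factor at `π/4` is harmless. -/
theorem jacobiEnergy_le_mul_exp {a b m D : ℝ} {p : ℝ[X]} (h : JacobiODE a b m p)
    (hL : 0 < 2 * m + a + b + 1) (hD : ∀ t, 0 < t → t ≤ π / 4 → |jacobiV a b t| ≤ D / t ^ 2)
    {t : ℝ} (h0 : 0 < t) (h1 : t ≤ π / 4) :
    jacobiEnergy a b (2 * m + a + b + 1) p t ≤
        jacobiEnergy a b (2 * m + a + b + 1) p (π / 4) * exp (D / ((2 * m + a + b + 1) * t)) ∧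
      jacobiEnergy a b (2 * m + a + b + 1) p (π / 4) ≤
        jacobiEnergy a b (2 * m + a + b + 1) p t * exp (D / ((2 * m + a + b + 1) * t)) := by
  have hder := fun {s : ℝ} (hs0 : 0 < s) (hs1 : s ≤ π / 4) =>
    have hsc := sin_pos_and_cos_pos hs0 (show s < π / 2 by linarith [pi_pos])
    hasDerivAt_jacobiEnergy h hsc.1 hsc.2
  set L := 2 * m + a + b + 1
  set E := jacobiEnergy a b L p
  have hE0 : ∀ s, 0 ≤ E s := jacobiEnergy_nonneg a b L p
  have hD0 : 0 ≤ D := by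
    have := (abs_nonneg _).trans (hD t h0 h1)
    by_contra hneg
    exact absurd this (not_le.2 (div_neg_of_neg_of_pos (not_le.1 hneg) (by positivity)))
  have hbd : ∀ s, 0 < s → s ≤ π / 4 →
      |-2 * jacobiV a b s * (jacobiU a b p s * jacobiUDeriv a b p s)| ≤ E s * (D / (L * s ^ 2)) := by
    intro s hs0 hs1
    have e1 := hD s hs0 hs1
    have e2 := two_mul_abs_jacobiU_mul_le a b L p s
    rw [abs_mul, abs_mul, abs_neg, abs_two]
    have e3 : |jacobiU a b p s * jacobiUDeriv a b p s| ≤ E s / (2 * L) := by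
      rw [le_div_iff₀ (by positivity)]; linarith
    calc 2 * |jacobiV a b s| * |jacobiU a b p s * jacobiUDeriv a b p s|
        ≤ 2 * (D / s ^ 2) * (E s / (2 * L)) := by gcongr
      _ = E s * (D / (L * s ^ 2)) := by field_simp
  have hexp : ∀ (c s : ℝ), 0 < s → HasDerivAt (fun s => exp (c * (D / (L * s))))
      (exp (c * (D / (L * s))) * (-c * (D / (L * s ^ 2)))) s := by
    intro c s hs
    have e := ((((hasDerivAt_id s).const_mul L).inv (by positivity)).const_mul (c * D)).exp
    refine (e.congr_deriv ?_).congr_of_eventuallyEq (.of_eq (funext fun x => ?_))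
    · simp only [id, Pi.inv_apply]
      rw [show c * D * (L * s)⁻¹ = c * (D / (L * s)) by ring]
      field_simp
    · simp only [id, Pi.inv_apply]
      congr 1
      ring
  have hF : ∀ c s : ℝ, 0 < s → s ≤ π / 4 → HasDerivAt (fun s => E s * exp (c * (D / (L * s))))
      (exp (c * (D / (L * s))) * (-2 * jacobiV a b s * (jacobiU a b p s * jacobiUDeriv a b p s)
        - c * (E s * (D / (L * s ^ 2))))) s := fun c s hs0 hs1 =>
    ((hder hs0 hs1).mul (hexp c s hs0)).congr_deriv (by ring)
  have hmono : MonotoneOn (fun s => E s * exp (-1 * (D / (L * s)))) (Set.Icc t (π / 4)) := by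
    refine monotoneOn_of_deriv_nonneg (convex_Icc _ _)
      (fun s hs => (hF _ s (h0.trans_le hs.1) hs.2).continuousAt.continuousWithinAt) ?_ ?_ <;>
    · intro s hs
      rw [interior_Icc] at hs
      have e := hF (-1) s (h0.trans hs.1) hs.2.le
      first
      | exact e.differentiableAt.differentiableWithinAt
      | rw [e.deriv]
        have := (abs_le.1 (hbd s (h0.trans hs.1) hs.2.le)).1
        exact mul_nonneg (exp_pos _).le (by linarith)
  have hanti : AntitoneOn (fun s => E s * exp (1 * (D / (L * s)))) (Set.Icc t (π / 4)) := by
    refine antitoneOn_of_deriv_nonpos (convex_Icc _ _)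
      (fun s hs => (hF _ s (h0.trans_le hs.1) hs.2).continuousAt.continuousWithinAt) ?_ ?_ <;>
    · intro s hs
      rw [interior_Icc] at hs
      have e := hF 1 s (h0.trans hs.1) hs.2.le
      first
      | exact e.differentiableAt.differentiableWithinAt
      | rw [e.deriv]
        have := (abs_le.1 (hbd s (h0.trans hs.1) hs.2.le)).2
        exact mul_nonpos_of_nonneg_of_nonpos (exp_pos _).le (by linarith)
  have l1 := hmono ⟨le_rfl, h1⟩ ⟨h1, le_rfl⟩ h1
  have l2 := hanti ⟨le_rfl, h1⟩ ⟨h1, le_rfl⟩ h1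
  simp only [neg_mul, one_mul] at l1 l2
  have hx : 0 ≤ D / (L * (π / 4)) := by positivity
  constructor
  · have : E t * exp (-(D / (L * t))) ≤ E (π / 4) :=
      l1.trans (mul_le_of_le_one_right (hE0 _) (exp_le_one_iff.2 (by linarith)))
    rwa [exp_neg, ← div_eq_mul_inv, div_le_iff₀ (exp_pos _)] at this
  · exact (le_mul_of_one_le_right (hE0 _) (one_le_exp hx)).trans l2

/-- For `L * t` bounded below, the energy at `t ≤ π / 4` is close to the energy at `π / 4`. -/
theorem exists_abs_jacobiEnergy_sub_le (a b : ℝ) {κ : ℝ} (hκ : 0 < κ) :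
    ∃ K ≥ 1, ∀ (m : ℝ) (p : ℝ[X]), JacobiODE a b m p → 0 < 2 * m + a + b + 1 →
      ∀ t, κ ≤ (2 * m + a + b + 1) * t → t ≤ π / 4 →
        |jacobiEnergy a b (2 * m + a + b + 1) p t -
            jacobiEnergy a b (2 * m + a + b + 1) p (π / 4)| ≤
          K * jacobiEnergy a b (2 * m + a + b + 1) p (π / 4) / ((2 * m + a + b + 1) * t) ∧
        jacobiEnergy a b (2 * m + a + b + 1) p t ≤
          K * jacobiEnergy a b (2 * m + a + b + 1) p (π / 4) := by
  obtain ⟨D, hD0, hD⟩ := exists_abs_jacobiV_le a b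
  -- The difference bound needs only the factor `D`; the added `1` serves the plain bound on the
  -- energy and `K ≥ 1`.
  refine ⟨(D + 1) * exp (D / κ), ?_, fun m p h hL t ht ht1 => ?_⟩
  · have : 1 ≤ exp (D / κ) := one_le_exp (by positivity)
    nlinarith
  have h0 : 0 < t := pos_of_mul_pos_right (hκ.trans_le ht) hL.le
  obtain ⟨e1, e2⟩ := jacobiEnergy_le_mul_exp h hL hD h0 ht1
  set L := 2 * m + a + b + 1
  have hE0 := jacobiEnergy_nonneg a b L p (π / 4)
  set E := jacobiEnergy a b L p t
  set E' := jacobiEnergy a b L p (π / 4)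
  have hLt : 0 < L * t := mul_pos hL h0
  set x := D / (L * t) with hx
  have hx0 : 0 ≤ x := by positivity
  have hxk : x ≤ D / κ := div_le_div_of_nonneg_left hD0.le hκ ht
  have hexp : exp x ≤ exp (D / κ) := exp_le_exp.2 hxk
  have h1e : 1 ≤ exp (D / κ) := one_le_exp (hx0.trans hxk)
  have hx1 : exp x - 1 ≤ x * exp x := by
    have := add_one_le_exp (-x)
    have h3 : exp x * exp (-x) = 1 := by rw [← exp_add]; simp
    nlinarith [exp_pos x]
  have hx2 : (1 - x) * E' ≤ E := by
    have h4 : E' * exp (-x) ≤ E := by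
      rw [exp_neg, ← div_eq_mul_inv, div_le_iff₀ (exp_pos _)]; exact e2
    have := add_one_le_exp (-x)
    nlinarith
  have hxx : x * exp x ≤ x * exp (D / κ) := by gcongr
  constructor
  · have key : |E - E'| ≤ x * exp (D / κ) * E' := by
      rw [abs_le]
      constructor
      · have : x * E' ≤ x * exp (D / κ) * E' := by
          have := mul_le_mul_of_nonneg_left h1e (mul_nonneg hx0 hE0)
          linarith
        linarith
      · have : (exp x - 1) * E' ≤ x * exp (D / κ) * E' := by
          gcongr; linarith
        linarith
    refine key.trans ?_
    rw [hx, show D / (L * t) * exp (D / κ) * E' = D * exp (D / κ) * E' / (L * t) by ring]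
    gcongr
    linarith
  · refine e1.trans ?_
    have : exp x * E' ≤ (D + 1) * exp (D / κ) * E' := by
      gcongr; nlinarith
    linarith

/-! ### Averaging of `u²` away from the endpoint. -/

theorem continuousOn_jacobiU {a b m : ℝ} {p : ℝ[X]} (h : JacobiODE a b m p) :
    ContinuousOn (jacobiU a b p) (Set.Ioo 0 (π / 2)) ∧
    ContinuousOn (jacobiUDeriv a b p) (Set.Ioo 0 (π / 2)) :=
  ⟨fun _ ht => have hsc := sin_pos_and_cos_pos ht.1 ht.2
    (hasDerivAt_jacobiU a b p hsc.1 hsc.2).continuousAt.continuousWithinAt,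
  fun _ ht => have hsc := sin_pos_and_cos_pos ht.1 ht.2
    (hasDerivAt_jacobiUDeriv h hsc.1 hsc.2).continuousAt.continuousWithinAt⟩

theorem continuousOn_jacobiV (a b : ℝ) : ContinuousOn (jacobiV a b) (Set.Ioo 0 (π / 2)) := by
  refine ContinuousOn.add ?_ ?_ <;> refine ContinuousOn.div (by fun_prop) (by fun_prop) ?_ <;>
  · intro t ht
    have hsc := sin_pos_and_cos_pos ht.1 ht.2
    have := hsc.1
    have := hsc.2
    positivity

theorem integral_rpow_neg_le {s t u : ℝ} (hs : 0 < s) (ht : 0 < t) (htu : t ≤ u) :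
    ∫ x in t..u, x ^ (-s - 1) ≤ t ^ (-s) / s := by
  rw [integral_rpow (Or.inr ⟨by linarith, fun h => by
    rw [Set.uIcc_of_le htu] at h; exact absurd h.1 (not_le.2 ht)⟩)]
  rw [show -s - 1 + 1 = -s by ring, div_neg, ← neg_div]
  have : 0 ≤ u ^ (-s) := rpow_nonneg (ht.le.trans htu) _
  gcongr
  linarith

/-- Equidistribution of `u ^ 2` against a weight `g` of size `t ^ (-s)`, away from the endpoint. -/
theorem exists_abs_integral_mul_jacobiU_sq_sub_le (a b : ℝ) {κ s G : ℝ} {g g' : ℝ → ℝ}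
    (hκ : 0 < κ) (hs : 0 < s) (hG : 0 ≤ G)
    (hg : ∀ t, 0 < t → t ≤ π / 4 → HasDerivAt g (g' t) t)
    (hg' : ContinuousOn g' (Set.Ioc 0 (π / 4)))
    (hgb : ∀ t, 0 < t → t ≤ π / 4 → |g t| ≤ G * t ^ (-s))
    (hgb' : ∀ t, 0 < t → t ≤ π / 4 → |g' t| ≤ G * t ^ (-s - 1)) :
    ∃ K, ∀ (m : ℝ) (p : ℝ[X]) (L : ℝ), L = 2 * m + a + b + 1 → JacobiODE a b m p → 0 < L →
      κ / L ≤ π / 4 →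
      |∫ t in (κ / L)..(π / 4), (2 * L ^ 2 * (g t * jacobiU a b p t ^ 2) -
        g t * jacobiEnergy a b L p (π / 4))| ≤ K * jacobiEnergy a b L p (π / 4) * L ^ (s - 1) := by
  obtain ⟨D, hD0, hD⟩ := exists_abs_jacobiV_le a b
  obtain ⟨C, hC1, hC⟩ := exists_abs_jacobiEnergy_sub_le a b hκ
  -- The first term bounds the boundary values of `g u u'` at `κ/L` and `π/4`. The second collects
  -- the errors `g (E - A)`, `g' u u'` and `g V u²`, each `O(A t^(-s-1) / L)`, after integration.
  refine ⟨G * κ ^ (-s) * C + (2 * G * C + G * D * C / κ) * (κ ^ (-s) / s), ?_⟩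
  intro m p L hLdef h hL hle
  have hCt := hC m p h (hLdef ▸ hL)
  rw [← hLdef] at hCt
  set A := jacobiEnergy a b L p (π / 4) with hA
  have hA0 : 0 ≤ A := jacobiEnergy_nonneg a b L p (π / 4)
  set c := κ / L with hc
  have hc0 : 0 < c := div_pos hκ hL
  set u := jacobiU a b p
  set v := jacobiUDeriv a b p
  set E := jacobiEnergy a b L p with hE
  have hpi : π / 4 < π / 2 := by linarith [pi_pos]
  have hmem : ∀ t ∈ Set.Icc c (π / 4), 0 < t ∧ t ≤ π / 4 ∧ κ ≤ L * t := fun t ht =>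
    ⟨hc0.trans_le ht.1, ht.2, by rw [← div_le_iff₀' hL]; exact ht.1⟩
  -- The derivative of `g u u'`. As `(u u')' = E - 2 L² u² - V u²`, adding it trades `2 L² g u²` for
  -- `g E` up to small terms.
  set H' : ℝ → ℝ := fun t => g' t * (u t * v t) +
    g t * (v t * v t + u t * (-(L ^ 2 + jacobiV a b t) * u t)) with hH'
  have hH : ∀ t ∈ Set.Icc c (π / 4), HasDerivAt (fun t => g t * (u t * v t)) (H' t) t := by
    intro t ht
    obtain ⟨h0, h1, -⟩ := hmem t ht
    have hsc := sin_pos_and_cos_pos h0 (h1.trans_lt hpi)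
    have e := hasDerivAt_jacobiUDeriv h hsc.1 hsc.2
    rw [← hLdef] at e
    exact (hg t h0 h1).mul ((hasDerivAt_jacobiU a b p hsc.1 hsc.2).mul e)
  have hsub : Set.Icc c (π / 4) ⊆ Set.Ioo 0 (π / 2) := fun t ht =>
    ⟨(hmem t ht).1, (hmem t ht).2.1.trans_lt hpi⟩
  have hsub' : Set.Icc c (π / 4) ⊆ Set.Ioc 0 (π / 4) := fun t ht =>
    ⟨(hmem t ht).1, (hmem t ht).2.1⟩
  have cu : ContinuousOn u _ := (continuousOn_jacobiU h).1.mono hsub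
  have cv : ContinuousOn v _ := (continuousOn_jacobiU h).2.mono hsub
  have cV := (continuousOn_jacobiV a b).mono hsub
  have cg : ContinuousOn g (Set.Icc c (π / 4)) := fun t ht =>
    (hg t (hmem t ht).1 (hmem t ht).2.1).continuousAt.continuousWithinAt
  have cg' := hg'.mono hsub'
  have cH' : ContinuousOn H' (Set.Icc c (π / 4)) := by
    rw [hH']; fun_prop
  have cF : ContinuousOn (fun t => 2 * L ^ 2 * (g t * u t ^ 2) - g t * A) (Set.Icc c (π / 4)) := by
    fun_prop
  have iH' := cH'.intervalIntegrable_of_Icc (μ := MeasureTheory.volume) hle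
  have iF := cF.intervalIntegrable_of_Icc (μ := MeasureTheory.volume) hle
  have huv : ∀ t ∈ Set.Icc c (π / 4), |u t * v t| ≤ C * A / (2 * L) := by
    intro t ht
    have e1 := two_mul_abs_jacobiU_mul_le a b L p t
    have e2 := (hCt t (hmem t ht).2.2 ht.2).2
    rw [le_div_iff₀ (by positivity)]
    linarith
  have hu2 : ∀ t ∈ Set.Icc c (π / 4), u t ^ 2 ≤ C * A / L ^ 2 := by
    intro t ht
    have e1 := sq_mul_jacobiU_sq_le a b L p t
    have e2 := (hCt t (hmem t ht).2.2 ht.2).2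
    rw [le_div_iff₀ (by positivity)]
    linarith
  have hpt : ∀ t ∈ Set.Icc c (π / 4), ‖2 * L ^ 2 * (g t * u t ^ 2) - g t * A + H' t‖ ≤
      (2 * G * C + G * D * C / κ) * A / L * t ^ (-s - 1) := by
    intro t ht
    obtain ⟨h0, h1, hk⟩ := hmem t ht
    have hts : 0 < t ^ (-s) := rpow_pos_of_pos h0 _
    have e1 : |g t * (E t - A)| ≤ G * C * A / L * t ^ (-s - 1) := by
      rw [abs_mul, rpow_sub_one h0.ne']
      calc |g t| * |E t - A| ≤ (G * t ^ (-s)) * (C * A / (L * t)) :=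
            mul_le_mul (hgb t h0 h1) (hCt t hk h1).1 (abs_nonneg _) (by positivity)
        _ = _ := by field_simp
    have e2 : |g' t * (u t * v t)| ≤ G * C * A / L * t ^ (-s - 1) := by
      rw [abs_mul]
      calc |g' t| * |u t * v t| ≤ (G * t ^ (-s - 1)) * (C * A / (2 * L)) :=
            mul_le_mul (hgb' t h0 h1) (huv t ht) (abs_nonneg _) (by positivity)
        _ = (G * C * A / L * t ^ (-s - 1)) / 2 := by field_simp
        _ ≤ _ := half_le_self (by positivity)
    have e3 : |g t * jacobiV a b t * u t ^ 2| ≤ G * D * C / κ * A / L * t ^ (-s - 1) := by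
      rw [abs_mul, abs_mul, abs_of_nonneg (sq_nonneg (u t)), rpow_sub_one h0.ne']
      calc |g t| * |jacobiV a b t| * u t ^ 2
          ≤ (G * t ^ (-s)) * (D / t ^ 2) * (C * A / L ^ 2) := by
            gcongr
            · exact hgb t h0 h1
            · exact hD t h0 h1
            · exact hu2 t ht
        _ = G * D * C * A / L * (t ^ (-s) / t) * (1 / (L * t)) := by field_simp
        _ ≤ G * D * C * A / L * (t ^ (-s) / t) * (1 / κ) := by gcongr
        _ = _ := by field_simp
    have e4 : 2 * L ^ 2 * (g t * u t ^ 2) - g t * A + H' t =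
        g t * (E t - A) + g' t * (u t * v t) - g t * jacobiV a b t * u t ^ 2 := by
      simp only [hH', hE, jacobiEnergy]
      ring
    rw [e4, Real.norm_eq_abs]
    calc _ ≤ |g t * (E t - A)| + |g' t * (u t * v t)| + |g t * jacobiV a b t * u t ^ 2| :=
          (abs_sub _ _).trans (add_le_add_left (abs_add_le _ _) _)
      _ ≤ G * C * A / L * t ^ (-s - 1) + G * C * A / L * t ^ (-s - 1) +
          G * D * C / κ * A / L * t ^ (-s - 1) := by linarith
      _ = _ := by ring
  have hbd : ∀ t ∈ Set.Icc c (π / 4), |g t * (u t * v t)| ≤ G * κ ^ (-s) * C * A * L ^ (s - 1) / 2 := by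
    intro t ht
    obtain ⟨h0, h1, hk⟩ := hmem t ht
    have e1 : t ^ (-s) ≤ κ ^ (-s) * L ^ s := by
      calc t ^ (-s) ≤ c ^ (-s) := rpow_le_rpow_of_nonpos hc0 ht.1 (by linarith)
        _ = _ := by rw [hc, div_rpow hκ.le hL.le, rpow_neg hL.le, div_inv_eq_mul]
    rw [abs_mul, rpow_sub_one hL.ne']
    calc |g t| * |u t * v t| ≤ (G * (κ ^ (-s) * L ^ s)) * (C * A / (2 * L)) :=
          mul_le_mul ((hgb t h0 h1).trans (by gcongr)) (huv t ht) (abs_nonneg _) (by positivity)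
      _ = _ := by field_simp
  have hint := intervalIntegral.norm_integral_le_of_norm_le hle
    (MeasureTheory.ae_of_all _ fun t ht => hpt t ⟨ht.1.le, ht.2⟩)
    ((ContinuousOn.intervalIntegrable_of_Icc (μ := MeasureTheory.volume) hle (by
      refine continuousOn_const.mul (ContinuousOn.rpow_const continuousOn_id fun t ht => Or.inl ?_)
      exact (hmem t ht).1.ne')))
  rw [intervalIntegral.integral_add iF iH', intervalIntegral.integral_const_mul,
    intervalIntegral.integral_eq_sub_of_hasDerivAt
      (fun t ht => hH t (by rwa [Set.uIcc_of_le hle] at ht)) iH', Real.norm_eq_abs] at hint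
  have b1 := abs_le.1 (hbd c ⟨le_rfl, hle⟩)
  have b2 := abs_le.1 (hbd (π / 4) ⟨hle, le_rfl⟩)
  have b3 : (2 * G * C + G * D * C / κ) * A / L * ∫ t in c..(π / 4), t ^ (-s - 1) ≤
      (2 * G * C + G * D * C / κ) * (κ ^ (-s) / s) * A * L ^ (s - 1) := by
    calc _ ≤ (2 * G * C + G * D * C / κ) * A / L * (c ^ (-s) / s) := by
          gcongr
          exact integral_rpow_neg_le hs hc0 hle
      _ = _ := by
          rw [hc, div_rpow hκ.le hL.le, rpow_neg hL.le, div_inv_eq_mul, rpow_sub_one hL.ne']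
          field_simp
  have b4 := abs_le.1 (hint.trans b3)
  rw [abs_le]
  constructor <;> linarith

/-! ### Control near the endpoint. -/

/-- Both `B - f` and `B + f` are monotone. Derivatives are required only in the interior, since
`x^(a+1)` need not be differentiable at `0`. -/
theorem abs_le_of_abs_deriv_le {f B f' B' : ℝ → ℝ} {y : ℝ} (hy : 0 ≤ y)
    (hf : ContinuousOn f (Set.Icc 0 y)) (hB : ContinuousOn B (Set.Icc 0 y))
    (hf' : ∀ x ∈ Set.Ioo 0 y, HasDerivAt f (f' x) x)
    (hB' : ∀ x ∈ Set.Ioo 0 y, HasDerivAt B (B' x) x)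
    (hle : ∀ x ∈ Set.Ioo 0 y, |f' x| ≤ B' x) (hf0 : f 0 = 0) (hB0 : B 0 = 0) : |f y| ≤ B y := by
  have key : ∀ F F' : ℝ → ℝ, ContinuousOn F (Set.Icc 0 y) →
      (∀ x ∈ Set.Ioo 0 y, HasDerivAt F (F' x) x) → (∀ x ∈ Set.Ioo 0 y, 0 ≤ F' x) → F 0 ≤ F y := by
    intro F F' hF hF' hnn
    refine monotoneOn_of_deriv_nonneg (convex_Icc _ _) hF ?_ ?_ ⟨le_rfl, hy⟩ ⟨hy, le_rfl⟩ hy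
    · rw [interior_Icc]
      exact fun x hx => (hF' x hx).differentiableAt.differentiableWithinAt
    · rw [interior_Icc]
      exact fun x hx => (hF' x hx).deriv.symm ▸ hnn x hx
  have k1 := key (B - f) (B' - f') (hB.sub hf) (fun x hx => (hB' x hx).sub (hf' x hx))
    (fun x hx => by have := abs_le.1 (hle x hx); simp only [Pi.sub_apply]; linarith)
  have k2 := key (B + f) (B' + f') (hB.add hf) (fun x hx => (hB' x hx).add (hf' x hx))
    (fun x hx => by have := abs_le.1 (hle x hx); simp only [Pi.add_apply]; linarith)
  simp only [Pi.sub_apply, Pi.add_apply, hf0, hB0] at k1 k2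
  rw [abs_le]
  constructor <;> linarith

theorem one_sub_rpow_le {c x : ℝ} (h0 : 0 ≤ x) (h1 : x ≤ 1 / 2) : (1 - x) ^ c ≤ 2 ^ |c| := by
  have h2 : 0 < 1 - x := by linarith
  calc (1 - x) ^ c ≤ (1 - x) ^ (-|c|) :=
        rpow_le_rpow_of_exponent_ge h2 (by linarith) (neg_abs_le c)
    _ ≤ (1 / 2) ^ (-|c|) := rpow_le_rpow_of_nonpos (by norm_num) (by linarith) (by simp)
    _ = 2 ^ |c| := by rw [rpow_neg (by norm_num), ← inv_rpow (by norm_num)]; norm_num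

/-- Integrate `(x^(a+1) (1-x)^(b+1) p')' = -μ x^a (1-x)^b p` from `0`. Both sides carry a factor
`x^(a+1)`, which cancels, so the bound is uniform down to `0`. -/
theorem JacobiODE.abs_derivative_le {a b m M x₁ : ℝ} {p : ℝ[X]} (h : JacobiODE a b m p)
    (ha : -1 < a) (hμ : 0 ≤ m * (m + a + b + 1)) (hx1 : x₁ ≤ 1 / 2)
    (hM : ∀ x ∈ Set.Icc 0 x₁, |p.eval x| ≤ M) {x : ℝ} (hx : x ∈ Set.Ioc 0 x₁) :
    |(derivative p).eval x| ≤ 2 ^ |b| * 2 ^ |-(b + 1)| / (a + 1) * (m * (m + a + b + 1)) * M := by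
  have ha1 : 0 < a + 1 := by linarith
  have hM0 : 0 ≤ M := (abs_nonneg _).trans (hM x ⟨hx.1.le, hx.2⟩)
  set μ := m * (m + a + b + 1) with hμd
  have key := abs_le_of_abs_deriv_le (y := x)
    (f := fun x => x ^ (a + 1) * (1 - x) ^ (b + 1) * (derivative p).eval x)
    (B := fun x => 2 ^ |b| * μ * M / (a + 1) * x ^ (a + 1))
    (f' := fun x => -μ * (x ^ a * (1 - x) ^ b * p.eval x))
    (B' := fun x => 2 ^ |b| * μ * M * x ^ a) hx.1.le ?_ ?_ ?_ ?_ ?_ ?_ ?_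
  · have h2 : 0 < 1 - x := by linarith [hx.2]
    have hxa : 0 < x ^ (a + 1) := rpow_pos_of_pos hx.1 _
    have hxb : 0 < (1 - x) ^ (b + 1) := rpow_pos_of_pos h2 _
    rw [abs_mul, abs_mul, abs_of_pos hxa, abs_of_pos hxb] at key
    replace key : |(derivative p).eval x| * (1 - x) ^ (b + 1) ≤ 2 ^ |b| * μ * M / (a + 1) :=
      le_of_mul_le_mul_right (by linarith) hxa
    have e1 : |(derivative p).eval x| ≤ 2 ^ |b| * μ * M / (a + 1) * (1 - x) ^ (-(b + 1)) := by
      rw [rpow_neg h2.le, ← div_eq_mul_inv, le_div_iff₀ hxb]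
      exact key
    refine e1.trans ?_
    calc 2 ^ |b| * μ * M / (a + 1) * (1 - x) ^ (-(b + 1))
        ≤ 2 ^ |b| * μ * M / (a + 1) * 2 ^ |-(b + 1)| := by
          gcongr
          exact one_sub_rpow_le hx.1.le (hx.2.trans hx1)
      _ = _ := by ring
  · refine ContinuousOn.mul (ContinuousOn.mul ?_ ?_) (by fun_prop)
    · exact (Real.continuous_rpow_const ha1.le).continuousOn
    · exact ContinuousOn.rpow_const (by fun_prop) fun y hy => Or.inl (by linarith [hy.2, hx.2])
  · exact ((Real.continuous_rpow_const ha1.le).const_mul _).continuousOn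
  · intro y hy
    have hy0 := hy.1
    have h2 : 0 < 1 - y := by linarith [hy.2, hx.2]
    refine ((hasDerivAt_rpow_mul_one_sub_rpow a b hy.1 (by linarith)).mul
      ((derivative p).hasDerivAt y)).congr_deriv ?_
    simp only [jacobiWeight, rpow_add hy0, rpow_add h2, rpow_one]
    linear_combination y ^ a * (1 - y) ^ b * h y
  · intro y hy
    refine ((hasDerivAt_rpow_const (x := y) (p := a + 1) (Or.inl hy.1.ne')).const_mul _).congr_deriv ?_
    rw [add_sub_cancel_right]
    field_simp
  · intro y hy
    have h2 : 0 < 1 - y := by linarith [hy.2, hx.2]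
    have hya : 0 < y ^ a := rpow_pos_of_pos hy.1 _
    have hyb : 0 < (1 - y) ^ b := rpow_pos_of_pos h2 _
    rw [abs_mul, abs_neg, abs_of_nonneg hμ, abs_mul, abs_mul, abs_of_pos hya, abs_of_pos hyb]
    have e1 : (1 - y) ^ b ≤ 2 ^ |b| := one_sub_rpow_le hy.1.le (by linarith [hy.2, hx.2])
    calc μ * (y ^ a * (1 - y) ^ b * |p.eval y|) ≤ μ * (y ^ a * 2 ^ |b| * M) := by
          gcongr
          exact hM y ⟨hy.1.le, hy.2.le.trans hx.2⟩
      _ = _ := by ring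
  · simp [zero_rpow ha1.ne']
  · simp [zero_rpow ha1.ne']

/-- On a short interval `[0, x₁]` the values of a solution of the Jacobi equation are controlled
by the value at `x₁`. -/
theorem JacobiODE.abs_eval_le {a b m x₁ : ℝ} {p : ℝ[X]} (h : JacobiODE a b m p)
    (ha : -1 < a) (hμ : 0 ≤ m * (m + a + b + 1)) (hx0 : 0 ≤ x₁) (hx1 : x₁ ≤ 1 / 2)
    (hsmall : 2 ^ |b| * 2 ^ |-(b + 1)| / (a + 1) * (m * (m + a + b + 1)) * x₁ ≤ 1 / 2)
    {x : ℝ} (hx : x ∈ Set.Icc 0 x₁) : |p.eval x| ≤ 2 * |p.eval x₁| := by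
  -- At a maximum point `y` of `|p|`, the mean value theorem and the smallness of `x₁` give `|p(x₁)
  -- - p(y)| ≤ M/2`.
  obtain ⟨y, hy, hmax⟩ := (isCompact_Icc (a := 0) (b := x₁)).exists_isMaxOn ⟨x₁, hx0, le_rfl⟩
    (f := fun x => |p.eval x|) (by fun_prop)
  have hM : ∀ z ∈ Set.Icc 0 x₁, |p.eval z| ≤ |p.eval y| := fun z hz => hmax hz
  set M := |p.eval y| with hMdef
  have hM0 : 0 ≤ M := abs_nonneg _
  set K := 2 ^ |b| * 2 ^ |-(b + 1)| / (a + 1) * (m * (m + a + b + 1)) with hK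
  have ha1 : 0 < a + 1 := by linarith
  have hK0 : 0 ≤ K := by positivity
  have hd : |p.eval x₁ - p.eval y| ≤ K * M * (x₁ - y) := by
    rcases hy.2.eq_or_lt with hyx | hyx
    · simp [hyx]
    obtain ⟨z, hz, hzd⟩ := exists_deriv_eq_slope (fun x => p.eval x) hyx
      (by fun_prop) (by fun_prop)
    rw [eq_div_iff (by linarith), Polynomial.deriv] at hzd
    rw [← hzd, abs_mul, abs_of_pos (sub_pos.2 hyx)]
    gcongr
    exact h.abs_derivative_le ha hμ hx1 hM ⟨hy.1.trans_lt hz.1, hz.2.le⟩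
  have h2 : K * M * (x₁ - y) ≤ M / 2 := by
    calc K * M * (x₁ - y) ≤ K * M * x₁ := by
          gcongr; linarith [hy.1]
      _ = (K * x₁) * M := by ring
      _ ≤ 1 / 2 * M := by gcongr
      _ = M / 2 := by ring
  have h3 : M - |p.eval x₁| ≤ |p.eval x₁ - p.eval y| := by
    rw [abs_sub_comm]; exact abs_sub_abs_le_abs_sub _ _
  linarith [hM x hx]

/-- Bounds for `u = jacobiU a b p` near the endpoint `0`, on the scale `1 / (2 m + a + b + 1)`. -/
theorem exists_jacobiU_sq_le {a b : ℝ} (ha : -1 / 2 ≤ a) (hb : -1 / 2 ≤ b) :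
    ∃ κ K : ℝ, 0 < κ ∧ κ ≤ 1 / 2 ∧ ∀ (m L : ℝ) (p : ℝ[X]), L = 2 * m + a + b + 1 →
      JacobiODE a b m p → 0 ≤ m → 1 ≤ L → ∀ t ∈ Set.Ioc 0 (κ / L),
        jacobiU a b p t ^ 2 ≤ K * jacobiU a b p (κ / L) ^ 2 ∧
        (0 ≤ a → cos t / sin t * jacobiU a b p t ^ 2 ≤ K * L * jacobiU a b p (κ / L) ^ 2) := by
  set K₀ : ℝ := 2 ^ |b| * 2 ^ |-(b + 1)| / (a + 1) with hK0
  have ha1 : 0 < a + 1 := by linarith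
  have hK0p : 0 < K₀ := by positivity
  -- Chosen so that `K₀ κ² ≤ 1/2`: with `μ ≤ L²` and `x₁ = sin² (κ/L) ≤ (κ/L)²`, this is the
  -- smallness required by `JacobiODE.abs_eval_le`.
  set κ : ℝ := 1 / (2 * (1 + K₀)) with hκ
  have hκ0 : 0 < κ := by positivity
  have hκ1 : κ ≤ 1 / 2 := by
    rw [hκ, div_le_div_iff₀ (by positivity) two_pos]; linarith
  have hκ2 : K₀ * κ ^ 2 ≤ 1 / 2 := by
    have : K₀ * κ ≤ 1 / 2 := by
      rw [hκ, mul_one_div, div_le_div_iff₀ (by positivity) two_pos]; linarith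
    nlinarith
  -- The `4` squares the factor `2` lost on `p`; the other factor comes from `cos t ≤ 1 ≤ 2 cos t₁`.
  set B : ℝ := 4 * ((2 : ℝ) ^ (b + 1 / 2)) ^ 2 with hB
  have hB0 : 0 < B := by positivity
  refine ⟨κ, max B (B * (2 / κ)), hκ0, hκ1, fun m L p hL h hm hL1 t ht => ?_⟩
  have hL0 : 0 < L := by linarith
  set t₁ := κ / L with ht1
  have ht10 : 0 < t₁ := by positivity
  have ht1half : t₁ ≤ 1 / 2 := by
    rw [ht1, div_le_iff₀ hL0]; linarith
  have hpi := pi_gt_three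
  obtain ⟨hs, hc⟩ := sin_pos_and_cos_pos ht.1 (by linarith [ht.2])
  obtain ⟨hs1, hc1⟩ := sin_pos_and_cos_pos ht10 (by linarith)
  have hss : sin t ≤ sin t₁ := sin_le_sin_of_le_of_le_pi_div_two (by linarith [ht.1])
    (by linarith) ht.2
  have hst : sin t₁ ≤ t₁ := sin_le ht10.le
  have hs1' : t₁ / 2 ≤ sin t₁ := half_le_sin ht10.le (by linarith)
  have hch : 1 / 2 ≤ cos t₁ := by
    have := half_le_cos_sq ht10.le (by linarith)
    nlinarith [cos_le_one t₁]
  have hx1 : sin t₁ ^ 2 ≤ 1 / 2 := by nlinarith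
  have hμ0 : 0 ≤ m * (m + a + b + 1) := mul_nonneg hm (by linarith)
  have hμ : m * (m + a + b + 1) ≤ L ^ 2 := by
    rw [hL]; nlinarith
  have hsmall : K₀ * (m * (m + a + b + 1)) * sin t₁ ^ 2 ≤ 1 / 2 := by
    calc K₀ * (m * (m + a + b + 1)) * sin t₁ ^ 2 ≤ K₀ * L ^ 2 * t₁ ^ 2 := by gcongr
      _ = K₀ * κ ^ 2 := by rw [ht1]; field_simp
      _ ≤ _ := hκ2
  have hp := h.abs_eval_le (by linarith) hμ0 (sq_nonneg _) hx1 hsmall (x := sin t ^ 2)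
    ⟨sq_nonneg _, by gcongr⟩
  have hp2 : p.eval (sin t ^ 2) ^ 2 ≤ 4 * p.eval (sin t₁ ^ 2) ^ 2 := by
    rw [← sq_abs, ← sq_abs (p.eval (sin t₁ ^ 2))]
    nlinarith [abs_nonneg (p.eval (sin t ^ 2))]
  have hcc : (cos t ^ (b + 1 / 2)) ^ 2 ≤
      ((2 : ℝ) ^ (b + 1 / 2)) ^ 2 * (cos t₁ ^ (b + 1 / 2)) ^ 2 := by
    rw [← mul_pow, ← mul_rpow two_pos.le hc1.le]
    gcongr
    · linarith
    · linarith [cos_le_one t]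
  have hu : ∀ X : ℝ, 0 ≤ X → X * (cos t ^ (b + 1 / 2)) ^ 2 * p.eval (sin t ^ 2) ^ 2 ≤
      B * (X * (cos t₁ ^ (b + 1 / 2)) ^ 2 * p.eval (sin t₁ ^ 2) ^ 2) := by
    intro X hX
    calc _ ≤ X * (((2 : ℝ) ^ (b + 1 / 2)) ^ 2 * (cos t₁ ^ (b + 1 / 2)) ^ 2) *
          (4 * p.eval (sin t₁ ^ 2) ^ 2) := by gcongr
      _ = _ := by ring
  have hU : ∀ s, jacobiU a b p s ^ 2 =
      (sin s ^ (a + 1 / 2)) ^ 2 * (cos s ^ (b + 1 / 2)) ^ 2 * p.eval (sin s ^ 2) ^ 2 := by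
    intro s; rw [jacobiU]; ring
  constructor
  · calc jacobiU a b p t ^ 2
        ≤ (sin t₁ ^ (a + 1 / 2)) ^ 2 * (cos t ^ (b + 1 / 2)) ^ 2 * p.eval (sin t ^ 2) ^ 2 := by
          rw [hU]
          gcongr
          linarith
      _ ≤ B * jacobiU a b p t₁ ^ 2 := by rw [hU t₁]; exact hu _ (by positivity)
      _ ≤ _ := by gcongr; exact le_max_left _ _
  · intro ha0
    -- The cotangent uses up one power of `sin`, leaving `sin^(2a)`, which is still monotone for `a
    -- ≥ 0`. Restoring that power at `t₁`, where `sin t₁ ≥ κ/(2L)`, costs the factor `L`.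
    have hsq : ∀ s : ℝ, 0 < s → (s ^ (a + 1 / 2)) ^ 2 = (s ^ a) ^ 2 * s := by
      intro s hs
      rw [rpow_add hs, mul_pow, ← sqrt_eq_rpow, sq_sqrt hs.le]
    have e1 : cos t / sin t * (sin t ^ (a + 1 / 2)) ^ 2 ≤ (sin t₁ ^ a) ^ 2 := by
      rw [hsq _ hs]
      calc cos t / sin t * ((sin t ^ a) ^ 2 * sin t) = cos t * (sin t ^ a) ^ 2 := by field_simp
        _ ≤ 1 * (sin t₁ ^ a) ^ 2 := by gcongr; exact cos_le_one t
        _ = _ := one_mul _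
    have e2 : (sin t₁ ^ a) ^ 2 ≤ 2 / κ * L * (sin t₁ ^ (a + 1 / 2)) ^ 2 := by
      rw [hsq _ hs1]
      have : 1 ≤ 2 / κ * L * sin t₁ := by
        calc 1 = 2 / κ * L * (t₁ / 2) := by rw [ht1]; field_simp
          _ ≤ _ := by gcongr
      calc (sin t₁ ^ a) ^ 2 ≤ (sin t₁ ^ a) ^ 2 * (2 / κ * L * sin t₁) :=
            le_mul_of_one_le_right (by positivity) this
        _ = _ := by ring
    calc cos t / sin t * jacobiU a b p t ^ 2
        = cos t / sin t * (sin t ^ (a + 1 / 2)) ^ 2 * (cos t ^ (b + 1 / 2)) ^ 2 *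
            p.eval (sin t ^ 2) ^ 2 := by rw [hU]; ring
      _ ≤ 2 / κ * L * (sin t₁ ^ (a + 1 / 2)) ^ 2 * (cos t ^ (b + 1 / 2)) ^ 2 *
            p.eval (sin t ^ 2) ^ 2 := 
            mul_le_mul_of_nonneg_right (mul_le_mul_of_nonneg_right (e1.trans e2) (by positivity))
              (by positivity)
      _ ≤ B * (2 / κ * L * (sin t₁ ^ (a + 1 / 2)) ^ 2 * (cos t₁ ^ (b + 1 / 2)) ^ 2 *
            p.eval (sin t₁ ^ 2) ^ 2) := hu _ (by positivity)
      _ = B * (2 / κ) * L * jacobiU a b p t₁ ^ 2 := by rw [hU t₁]; ring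
      _ ≤ _ := by gcongr; exact le_max_right _ _

/-! ### Plain and `cot`-weighted mass on `[0, π/4]`. -/

theorem hasDerivAt_cos_div_sin {t : ℝ} (hs : 0 < sin t) :
    HasDerivAt (fun t => cos t / sin t) (-(1 / sin t ^ 2)) t := by
  refine ((hasDerivAt_cos t).div (hasDerivAt_sin t) hs.ne').congr_deriv ?_
  have := sin_sq_add_cos_sq t
  field_simp
  linarith

theorem abs_cos_div_sin_le {t : ℝ} (h0 : 0 < t) (h1 : t ≤ π / 4) :
    |cos t / sin t| ≤ 4 * t ^ (-1 : ℝ) := by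
  have hs := half_le_sin h0.le h1
  have hs0 : 0 < sin t := by linarith
  rw [abs_div, abs_of_pos hs0, rpow_neg_one, ← div_eq_mul_inv, div_le_div_iff₀ hs0 h0]
  nlinarith [abs_cos_le_one t]

theorem abs_one_div_sin_sq_le {t : ℝ} (h0 : 0 < t) (h1 : t ≤ π / 4) :
    |-(1 / sin t ^ 2)| ≤ 4 * t ^ (-1 - 1 : ℝ) := by
  have hs := half_le_sin h0.le h1
  have hs0 : 0 < sin t := by linarith
  rw [abs_neg, abs_of_pos (by positivity), rpow_sub_one h0.ne', rpow_neg_one,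
    show 4 * (t⁻¹ / t) = 4 / t ^ 2 by field_simp, div_le_div_iff₀ (by positivity) (by positivity)]
  nlinarith

/-- The source of the logarithm: `log sin` is a primitive, and `κ/(2L) ≤ sin (κ/L) ≤ κ/L`. -/
theorem abs_integral_cos_div_sin_sub_log_le {κ L : ℝ} (hκ : 0 < κ) (hL : 0 < L)
    (h : κ / L ≤ π / 4) :
    |(∫ t in (κ / L)..(π / 4), cos t / sin t) - log L| ≤
      |log (sin (π / 4))| + |log κ| + |log (κ / 2)| := by
  have h0 : 0 < κ / L := by positivity
  have hs : ∀ t ∈ Set.uIcc (κ / L) (π / 4), 0 < sin t := by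
    intro t ht
    rw [Set.uIcc_of_le h] at ht
    exact (sin_pos_and_cos_pos (h0.trans_le ht.1) (by linarith [ht.2, pi_pos])).1
  rw [intervalIntegral.integral_eq_sub_of_hasDerivAt (f := fun t => log (sin t))
    (fun t ht => (hasDerivAt_sin t).log (hs t ht).ne')
    (ContinuousOn.intervalIntegrable (continuousOn_cos.div continuousOn_sin
      fun t ht => (hs t ht).ne'))]
  have hs0 := hs _ Set.left_mem_uIcc
  have h1 : log (sin (κ / L)) ≤ log κ - log L := by
    rw [← log_div hκ.ne' hL.ne']
    exact log_le_log hs0 (sin_le h0.le)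
  have h2 : log (κ / 2) - log L ≤ log (sin (κ / L)) := by
    rw [← log_div (by positivity) hL.ne']
    refine log_le_log (by positivity) ?_
    have := half_le_sin h0.le h
    calc κ / 2 / L = κ / L / 2 := by ring
      _ ≤ _ := this
  rw [abs_le]
  constructor <;>
    linarith [le_abs_self (log (sin (π / 4))), neg_abs_le (log (sin (π / 4))), le_abs_self (log κ),
      neg_abs_le (log κ), le_abs_self (log (κ / 2)), neg_abs_le (log (κ / 2))]

/-- A pointwise bound on `[0, c]` and an integral estimate on `[c, π / 4]` give an integral estimate
on `[0, π / 4]`. -/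
theorem abs_two_mul_integral_sub_le {F : ℝ → ℝ} {L c A I B₁ B₂ : ℝ}
    (h0 : 0 ≤ c) (hc : c ≤ π / 4)
    (hF : IntervalIntegrable F MeasureTheory.volume 0 (π / 4))
    (h1 : ∀ t ∈ Set.Ioc 0 c, |F t| ≤ B₁)
    (h2 : |2 * L ^ 2 * (∫ t in c..(π / 4), F t) - I * A| ≤ B₂) :
    |2 * L ^ 2 * (∫ t in (0)..(π / 4), F t) - I * A| ≤ 2 * L ^ 2 * (B₁ * c) + B₂ := by
  have hsub1 : Set.uIcc 0 c ⊆ Set.uIcc 0 (π / 4) := by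
    rw [Set.uIcc_of_le h0, Set.uIcc_of_le (h0.trans hc)]
    exact Set.Icc_subset_Icc le_rfl hc
  have hsub2 : Set.uIcc c (π / 4) ⊆ Set.uIcc 0 (π / 4) := by
    rw [Set.uIcc_of_le hc, Set.uIcc_of_le (h0.trans hc)]
    exact Set.Icc_subset_Icc h0 le_rfl
  rw [← intervalIntegral.integral_add_adjacent_intervals (hF.mono_set hsub1) (hF.mono_set hsub2)]
  have h3 := intervalIntegral.norm_integral_le_of_norm_le_const (a := 0) (b := c) (f := F) (C := B₁)
    (fun t ht => by rw [Set.uIoc_of_le h0] at ht; exact h1 t ht)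
  rw [sub_zero, abs_of_nonneg h0, Real.norm_eq_abs] at h3
  calc _ = |2 * L ^ 2 * (∫ t in (0)..c, F t) + (2 * L ^ 2 * (∫ t in c..(π / 4), F t) - I * A)| := by
        congr 1; ring
    _ ≤ |2 * L ^ 2 * (∫ t in (0)..c, F t)| + B₂ := (abs_add_le _ _).trans (by gcongr)
    _ ≤ _ := by
      rw [abs_mul, abs_of_nonneg (by positivity : 0 ≤ 2 * L ^ 2)]
      gcongr

/-- Mass and `cot`-weighted mass of `u ^ 2` on the half interval `[0, π / 4]`. -/
theorem exists_abs_integral_jacobiU_sq_sub_le {a b : ℝ} (ha : -1 / 2 ≤ a) (hb : -1 / 2 ≤ b) :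
    ∃ K : ℝ, ∀ (m L : ℝ) (p : ℝ[X]), L = 2 * m + a + b + 1 →
      JacobiODE a b m p → 0 ≤ m → 1 ≤ L →
      (IntervalIntegrable (fun t => jacobiU a b p t ^ 2) MeasureTheory.volume 0 (π / 4) →
        |2 * L ^ 2 * (∫ t in (0)..(π / 4), jacobiU a b p t ^ 2) -
          π / 4 * jacobiEnergy a b L p (π / 4)| ≤
            K * jacobiEnergy a b L p (π / 4) * L ^ (-1 / 2 : ℝ)) ∧
      (0 ≤ a → IntervalIntegrable (fun t => cos t / sin t * jacobiU a b p t ^ 2)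
          MeasureTheory.volume 0 (π / 4) →
        |2 * L ^ 2 * (∫ t in (0)..(π / 4), cos t / sin t * jacobiU a b p t ^ 2) -
          log L * jacobiEnergy a b L p (π / 4)| ≤ K * jacobiEnergy a b L p (π / 4)) := by
  obtain ⟨κ, K₀, hκ, hκ1, hK₀⟩ := exists_jacobiU_sq_le ha hb
  obtain ⟨C, hC1, hC⟩ := exists_abs_jacobiEnergy_sub_le a b hκ
  -- As `t ≤ 1`, the weight `1` is below `t^(-s)` for every `s > 0`; any `s < 1` makes the relative
  -- error `L^(s-1)` tend to zero.
  obtain ⟨K₁, hK₁⟩ := exists_abs_integral_mul_jacobiU_sq_sub_le a b (s := 1 / 2) (G := 1)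
    (g := fun _ => 1) (g' := fun _ => 0) hκ (by norm_num) zero_le_one
    (fun t _ _ => hasDerivAt_const _ _) continuousOn_const
    (fun t h0 h1 => by
      rw [abs_one, one_mul]
      exact one_le_rpow_of_pos_of_le_one_of_nonpos h0 (by linarith [pi_le_four]) (by norm_num))
    (fun t h0 h1 => by rw [abs_zero]; positivity)
  -- Here `cot t` has size `1/t`, so `s = 1`; the relative error is only bounded, which suffices
  -- against `log L`.
  obtain ⟨K₂, hK₂⟩ := exists_abs_integral_mul_jacobiU_sq_sub_le a b (s := 1) (G := 4)
    (g := fun t => cos t / sin t) (g' := fun t => -(1 / sin t ^ 2)) hκ zero_lt_one (by norm_num)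
    (fun t h0 h1 => hasDerivAt_cos_div_sin
      (sin_pos_and_cos_pos h0 (by linarith [pi_pos])).1)
    (ContinuousOn.neg (continuousOn_const.div (by fun_prop) fun t ht =>
      pow_ne_zero _ (sin_pos_and_cos_pos ht.1 (by linarith [ht.2, pi_pos])).1.ne'))
    (fun t h0 h1 => abs_cos_div_sin_le h0 h1)
    (fun t h0 h1 => abs_one_div_sin_sq_le h0 h1)
  set J := |log (sin (π / 4))| + |log κ| + |log (κ / 2)|
  -- The common term pays for `[0, κ/L]`; `κ` and `J` correct the integrals of the weights over
  -- `[κ/L, π/4]` to `π/4` and `log L`.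
  refine ⟨max (2 * |K₀| * C * κ + (K₁ + κ)) (2 * |K₀| * C * κ + (K₂ + J)), ?_⟩
  intro m L p hL h hm hL1
  have hL0 : 0 < L := by linarith
  have hc0 : 0 < κ / L := by positivity
  have hc : κ / L ≤ π / 4 := by
    have : κ / L ≤ κ := div_le_self hκ.le hL1
    linarith [pi_gt_three]
  have hLc : L * (κ / L) = κ := by field_simp
  have hK0 := hK₀ m L p hL h hm hL1
  have hC0 := (hC m p h (hL ▸ hL0) (κ / L) (by rw [← hL, hLc]) hc).2
  rw [← hL] at hC0
  have h1 := hK₁ m p L hL h hL0 hc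
  have h2 := hK₂ m p L hL h hL0 hc
  set A := jacobiEnergy a b L p (π / 4) with hA
  have hA0 : 0 ≤ A := jacobiEnergy_nonneg a b L p (π / 4)
  set u := jacobiU a b p with hu
  have hU : u (κ / L) ^ 2 ≤ C * A / L ^ 2 := by
    rw [le_div_iff₀ (by positivity)]
    linarith [sq_mul_jacobiU_sq_le a b L p (κ / L)]
  have hsub2 : Set.uIcc (κ / L) (π / 4) ⊆ Set.uIcc 0 (π / 4) := by
    rw [Set.uIcc_of_le hc, Set.uIcc_of_le (hc0.le.trans hc)]
    exact Set.Icc_subset_Icc hc0.le le_rfl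
  constructor
  · intro hi
    have e1 : L ^ (1 / 2 - 1 : ℝ) = L ^ (-1 / 2 : ℝ) := by norm_num
    have e2 : 1 / L ≤ L ^ (-1 / 2 : ℝ) := by
      rw [one_div, ← rpow_neg_one]
      exact rpow_le_rpow_of_exponent_le hL1 (by norm_num)
    have key := abs_two_mul_integral_sub_le (F := fun t => u t ^ 2) (L := L) (c := κ / L)
      (A := A) (I := π / 4) (B₁ := |K₀| * (C * A / L ^ 2))
      (B₂ := (K₁ + κ) * A * L ^ (-1 / 2 : ℝ)) hc0.le hc hi ?_ ?_
    · refine key.trans ?_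
      calc 2 * L ^ 2 * (|K₀| * (C * A / L ^ 2) * (κ / L)) + (K₁ + κ) * A * L ^ (-1 / 2 : ℝ)
          = 2 * |K₀| * C * κ * A * (1 / L) + (K₁ + κ) * A * L ^ (-1 / 2 : ℝ) := by
            field_simp
        _ ≤ 2 * |K₀| * C * κ * A * L ^ (-1 / 2 : ℝ) + (K₁ + κ) * A * L ^ (-1 / 2 : ℝ) := by
            gcongr
        _ = (2 * |K₀| * C * κ + (K₁ + κ)) * A * L ^ (-1 / 2 : ℝ) := by ring
        _ ≤ _ := by gcongr; exact le_max_left _ _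
    · intro t ht
      rw [abs_of_nonneg (sq_nonneg _)]
      calc u t ^ 2 ≤ K₀ * u (κ / L) ^ 2 := (hK0 t ht).1
        _ ≤ |K₀| * (C * A / L ^ 2) := by
          gcongr
          exact le_abs_self _
    · have hi2 : IntervalIntegrable (fun t => 2 * L ^ 2 * u t ^ 2) MeasureTheory.volume
          (κ / L) (π / 4) := (hi.mono_set hsub2).const_mul _
      simp only [one_mul] at h1
      rw [intervalIntegral.integral_sub hi2 (by simp),
        intervalIntegral.integral_const_mul, intervalIntegral.integral_const, smul_eq_mul, e1,
        abs_le] at h1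
      have e3 : κ / L * A ≤ κ * A * L ^ (-1 / 2 : ℝ) := by
        calc κ / L * A = κ * A * (1 / L) := by ring
          _ ≤ _ := by gcongr
      have e4 : 0 ≤ κ / L * A := by positivity
      rw [abs_le]
      constructor <;> linarith
  · intro ha0 hi
    have hJ := abs_le.1 (abs_integral_cos_div_sin_sub_log_le hκ hL0 hc)
    have key := abs_two_mul_integral_sub_le (F := fun t => cos t / sin t * u t ^ 2) (L := L)
      (c := κ / L) (A := A) (I := log L) (B₁ := |K₀| * L * (C * A / L ^ 2))
      (B₂ := (K₂ + J) * A) hc0.le hc hi ?_ ?_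
    · refine key.trans ?_
      calc 2 * L ^ 2 * (|K₀| * L * (C * A / L ^ 2) * (κ / L)) + (K₂ + J) * A
          = (2 * |K₀| * C * κ + (K₂ + J)) * A := by
            field_simp
        _ ≤ _ := by gcongr; exact le_max_right _ _
    · intro t ht
      have hsc := sin_pos_and_cos_pos ht.1 (by linarith [ht.2, pi_pos])
      have := hsc.1
      have := hsc.2
      rw [abs_of_nonneg (by positivity)]
      calc cos t / sin t * u t ^ 2 ≤ K₀ * L * u (κ / L) ^ 2 := (hK0 t ht).2 ha0
        _ ≤ |K₀| * L * (C * A / L ^ 2) := by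
          gcongr
          exact le_abs_self _
    · have hi2 : IntervalIntegrable (fun t => 2 * L ^ 2 * (cos t / sin t * u t ^ 2))
          MeasureTheory.volume (κ / L) (π / 4) := (hi.mono_set hsub2).const_mul _
      have hi3 : IntervalIntegrable (fun t => cos t / sin t * A)
          MeasureTheory.volume (κ / L) (π / 4) := by
        refine ContinuousOn.intervalIntegrable (ContinuousOn.mul
          (continuousOn_cos.div continuousOn_sin fun t ht => ?_) continuousOn_const)
        rw [Set.uIcc_of_le hc] at ht
        exact (sin_pos_and_cos_pos (hc0.trans_le ht.1) (by linarith [ht.2, pi_pos])).1.ne'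
      rw [intervalIntegral.integral_sub hi2 hi3, intervalIntegral.integral_const_mul,
        intervalIntegral.integral_mul_const, sub_self, rpow_zero, mul_one, abs_le] at h2
      have e1 := mul_le_mul_of_nonneg_right hJ.1 hA0
      have e2 := mul_le_mul_of_nonneg_right hJ.2 hA0
      rw [abs_le]
      constructor <;> linarith

/-! ### Change of variables `x = sin² t` and normalization. -/

theorem image_sin_sq_Ioo : (fun t => sin t ^ 2) '' Set.Ioo 0 (π / 2) = Set.Ioo (0 : ℝ) 1 := by
  ext x
  constructor
  · rintro ⟨t, ht, rfl⟩
    have hsc := sin_pos_and_cos_pos ht.1 ht.2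
    have := sin_sq_add_cos_sq t
    exact ⟨pow_pos hsc.1 2, by nlinarith [hsc.2]⟩
  · rintro ⟨h0, h1⟩
    have hs : √x < 1 := by rw [sqrt_lt' one_pos]; simpa using h1
    refine ⟨arcsin √x, ⟨arcsin_pos.2 (sqrt_pos.2 h0), arcsin_lt_pi_div_two.2 hs⟩, ?_⟩
    simp only
    rw [sin_arcsin (by linarith [sqrt_nonneg x]) hs.le, sq_sqrt h0.le]

theorem injOn_sin_sq : Set.InjOn (fun t => sin t ^ 2) (Set.Ioo 0 (π / 2)) := by
  intro s hs t ht hst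
  have h1 := sin_pos_and_cos_pos hs.1 hs.2
  have h2 := sin_pos_and_cos_pos ht.1 ht.2
  have h3 : sin s = sin t := (sq_eq_sq₀ h1.1.le h2.1.le).1 hst
  exact injOn_sin ⟨by linarith [hs.1, pi_pos], hs.2.le⟩ ⟨by linarith [ht.1, pi_pos], ht.2.le⟩ h3

/-- The Jacobian `2 sin t cos t` accounts for the exponents `1/2` in `jacobiU`. -/
theorem two_mul_jacobiU_sq (a b : ℝ) (p : ℝ[X]) {t : ℝ} (ht : t ∈ Set.Ioo 0 (π / 2)) :
    |2 * sin t * cos t| • (p.eval (sin t ^ 2) * p.eval (sin t ^ 2) *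
      jacobiWeight a b (sin t ^ 2)) = 2 * jacobiU a b p t ^ 2 := by
  obtain ⟨hs, hc⟩ := sin_pos_and_cos_pos ht.1 ht.2
  have h1 : 1 - sin t ^ 2 = cos t ^ 2 := by have := sin_sq_add_cos_sq t; linarith
  have h2 : ∀ x c : ℝ, 0 < x → (x ^ 2) ^ c = (x ^ c) ^ 2 := by
    intro x c hx
    rw [← rpow_natCast, ← rpow_natCast, ← rpow_mul hx.le, ← rpow_mul hx.le, mul_comm]
  rw [abs_of_pos (by positivity), smul_eq_mul, jacobiWeight, jacobiU, h1, h2 _ _ hs, h2 _ _ hc,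
    rpow_add hs, rpow_add hc, ← sqrt_eq_rpow, ← sqrt_eq_rpow]
  have e1 := sq_sqrt hs.le
  have e2 := sq_sqrt hc.le
  simp only [mul_pow, e1, e2]
  ring

/-- The substitution `x = sin t ^ 2` in the Jacobi inner product. -/
theorem jacobiInner_self_eq_integral_jacobiU {a b : ℝ} (ha : -1 < a) (hb : -1 < b) (p : ℝ[X]) :
    IntervalIntegrable (fun t => jacobiU a b p t ^ 2) MeasureTheory.volume 0 (π / 2) ∧
      jacobiInner a b p p = 2 * ∫ t in (0)..(π / 2), jacobiU a b p t ^ 2 := by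
  have hpi : (0 : ℝ) ≤ π / 2 := by positivity
  have hd : ∀ t ∈ Set.Ioo 0 (π / 2), HasDerivWithinAt (fun t => sin t ^ 2) (2 * sin t * cos t)
      (Set.Ioo 0 (π / 2)) t := fun t _ =>
    (((hasDerivAt_sin t).pow 2).congr_deriv (by norm_num)).hasDerivWithinAt
  have hint := intervalIntegrable_eval_mul_jacobiWeight ha hb p p
  rw [intervalIntegrable_iff_integrableOn_Ioo_of_le zero_le_one, ← image_sin_sq_Ioo,
    MeasureTheory.integrableOn_image_iff_integrableOn_abs_deriv_smul measurableSet_Ioo hd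
      injOn_sin_sq,
    MeasureTheory.integrableOn_congr_fun (fun t ht => two_mul_jacobiU_sq a b p ht)
      measurableSet_Ioo, ← intervalIntegrable_iff_integrableOn_Ioo_of_le hpi] at hint
  refine ⟨by simpa using hint.const_mul (1 / 2), ?_⟩
  rw [jacobiInner, intervalIntegral.integral_of_le zero_le_one,
    MeasureTheory.integral_Ioc_eq_integral_Ioo, ← image_sin_sq_Ioo,
    MeasureTheory.integral_image_eq_integral_abs_deriv_smul measurableSet_Ioo hd injOn_sin_sq,
    MeasureTheory.setIntegral_congr_fun measurableSet_Ioo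
      (fun t ht => two_mul_jacobiU_sq a b p ht), ← MeasureTheory.integral_Ioc_eq_integral_Ioo,
    ← intervalIntegral.integral_of_le hpi, intervalIntegral.integral_const_mul]

/-- Under the substitution `x^(-1/2) (1-x)^(1/2)` becomes `cot t`; `a > -1/2` keeps the shifted
exponent above `-1`. -/
theorem jacobiInner_shift_eq_integral_jacobiU {a b : ℝ} (ha : -1 / 2 < a) (hb : -1 < b)
    (p : ℝ[X]) :
    IntervalIntegrable (fun t => cos t / sin t * jacobiU a b p t ^ 2)
        MeasureTheory.volume 0 (π / 2) ∧
      jacobiInner (a - 1 / 2) (b + 1 / 2) p p =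
        2 * ∫ t in (0)..(π / 2), cos t / sin t * jacobiU a b p t ^ 2 := by
  have hpi : (0 : ℝ) ≤ π / 2 := by positivity
  obtain ⟨h1, h2⟩ := jacobiInner_self_eq_integral_jacobiU (a := a - 1 / 2) (b := b + 1 / 2)
    (by linarith) (by linarith) p
  have key : Set.EqOn (fun t => jacobiU (a - 1 / 2) (b + 1 / 2) p t ^ 2)
      (fun t => cos t / sin t * jacobiU a b p t ^ 2) (Set.Ioo 0 (π / 2)) := by
    intro t ht
    obtain ⟨hs, hc⟩ := sin_pos_and_cos_pos ht.1 ht.2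
    simp only [jacobiU, rpow_add hs, rpow_add hc, rpow_sub hs, ← sqrt_eq_rpow]
    have e1 := sq_sqrt hs.le
    have e2 := sq_sqrt hc.le
    have e3 := sqrt_pos.2 hs
    simp only [mul_pow, div_pow, e1, e2]
    field_simp
  constructor
  · rw [intervalIntegrable_iff_integrableOn_Ioo_of_le hpi] at h1 ⊢
    exact (MeasureTheory.integrableOn_congr_fun key measurableSet_Ioo).1 h1
  · rw [h2, intervalIntegral.integral_of_le hpi, intervalIntegral.integral_of_le hpi,
      MeasureTheory.integral_Ioc_eq_integral_Ioo, MeasureTheory.integral_Ioc_eq_integral_Ioo,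
      MeasureTheory.setIntegral_congr_fun measurableSet_Ioo key]

theorem integral_jacobiU_sq_right (a b : ℝ) (p : ℝ[X]) :
    ∫ t in (π / 4)..(π / 2), jacobiU a b p t ^ 2 =
      ∫ t in (0)..(π / 4), jacobiU b a (p.comp (1 - X)) t ^ 2 := by
  simp only [jacobiU_comp_one_sub]
  rw [intervalIntegral.integral_comp_sub_left (fun t => jacobiU a b p t ^ 2) (π / 2)]
  congr 1 <;> ring

/-- For a normalized solution of the Jacobi equation, its energy at `π / 4` is close to
`2 / π * L ^ 2`, and its mass against the shifted weight is close to `log L` times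
the energy divided by `L ^ 2`. -/
theorem exists_jacobiInner_shift_estimate {a b : ℝ} (ha : 0 ≤ a) (hb : -1 / 2 ≤ b) :
    ∃ K : ℝ, ∀ (m L : ℝ) (p : ℝ[X]), L = 2 * m + a + b + 1 →
      JacobiODE a b m p → jacobiInner a b p p = 1 → 0 ≤ m → 1 ≤ L →
      |1 - π / 2 * (jacobiEnergy a b L p (π / 4) / L ^ 2)| ≤
          K * (jacobiEnergy a b L p (π / 4) / L ^ 2) * L ^ (-1 / 2 : ℝ) ∧
      |jacobiInner (a - 1 / 2) (b + 1 / 2) p p -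
          jacobiEnergy a b L p (π / 4) / L ^ 2 * log L| ≤
        K * (jacobiEnergy a b L p (π / 4) / L ^ 2) + 1 := by
  obtain ⟨K₁, hK₁⟩ := exists_abs_integral_jacobiU_sq_sub_le (a := a) (by linarith) hb
  obtain ⟨K₂, hK₂⟩ := exists_abs_integral_jacobiU_sq_sub_le hb (b := a) (by linarith)
  refine ⟨max (K₁ + K₂) K₁, fun m L p hL h hp hm hL1 => ?_⟩
  have hL0 : 0 < L := by linarith
  have hpi := pi_pos
  obtain ⟨i1, j1⟩ := jacobiInner_self_eq_integral_jacobiU (a := a) (b := b)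
    (by linarith) (by linarith) p
  obtain ⟨i2, j2⟩ := jacobiInner_shift_eq_integral_jacobiU (a := a) (b := b)
    (by linarith) (by linarith) p
  obtain ⟨i3, -⟩ := jacobiInner_self_eq_integral_jacobiU (a := b) (b := a)
    (by linarith) (by linarith) (p.comp (1 - X))
  have hsub1 : Set.uIcc 0 (π / 4) ⊆ Set.uIcc 0 (π / 2) := by
    rw [Set.uIcc_of_le (by linarith), Set.uIcc_of_le (by linarith)]
    exact Set.Icc_subset_Icc le_rfl (by linarith)
  have hsub2 : Set.uIcc (π / 4) (π / 2) ⊆ Set.uIcc 0 (π / 2) := by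
    rw [Set.uIcc_of_le (by linarith), Set.uIcc_of_le (by linarith)]
    exact Set.Icc_subset_Icc (by linarith) le_rfl
  have e1 := (hK₁ m L p hL h hm hL1).1 (i1.mono_set hsub1)
  have e2 := (hK₁ m L p hL h hm hL1).2 ha (i2.mono_set hsub1)
  -- The right half is the left half of the reflected polynomial. The point `π/4` is fixed by `t ↦
  -- π/2 - t`, so the same energy `A` occurs in both estimates.
  have e3 := (hK₂ m L _ (by rw [hL]; ring) h.comp_one_sub hm hL1).1 (i3.mono_set hsub1)
  rw [← integral_jacobiU_sq_right, jacobiEnergy_comp_one_sub,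
    show π / 2 - π / 4 = π / 4 by ring] at e3
  rw [hp, ← intervalIntegral.integral_add_adjacent_intervals (i1.mono_set hsub1)
    (i1.mono_set hsub2)] at j1
  rw [← intervalIntegral.integral_add_adjacent_intervals (i2.mono_set hsub1)
    (i2.mono_set hsub2)] at j2
  -- On the right half `cot ≤ 1`, so its contribution is at most the total mass `1`: this is the `+
  -- 1` of the conclusion.
  have hcot : ∀ t ∈ Set.Icc (π / 4) (π / 2), 0 ≤ cos t / sin t ∧ cos t / sin t ≤ 1 := by
    intro t ht
    have hc : 0 ≤ cos t := cos_nonneg_of_mem_Icc ⟨by linarith [ht.1], ht.2⟩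
    have hs : 0 < sin t := sin_pos_of_pos_of_lt_pi (by linarith [ht.1]) (by linarith [ht.2])
    refine ⟨by positivity, (div_le_one hs).2 ?_⟩
    rw [← sin_pi_div_two_sub]
    exact sin_le_sin_of_le_of_le_pi_div_two (by linarith [ht.2]) ht.2 (by linarith [ht.1])
  have r1 : 0 ≤ ∫ t in (π / 4)..(π / 2), cos t / sin t * jacobiU a b p t ^ 2 :=
    intervalIntegral.integral_nonneg (by linarith) fun t ht =>
      mul_nonneg (hcot t ht).1 (sq_nonneg _)
  have r2 : ∫ t in (π / 4)..(π / 2), cos t / sin t * jacobiU a b p t ^ 2 ≤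
      ∫ t in (π / 4)..(π / 2), jacobiU a b p t ^ 2 :=
    intervalIntegral.integral_mono_on (by linarith) (i2.mono_set hsub2) (i1.mono_set hsub2)
      fun t ht => mul_le_of_le_one_left (sq_nonneg _) (hcot t ht).2
  have r3 : 0 ≤ ∫ t in (0)..(π / 4), jacobiU a b p t ^ 2 :=
    intervalIntegral.integral_nonneg (by linarith) fun t _ => sq_nonneg _
  set A := jacobiEnergy a b L p (π / 4) with hA
  have hA0 : 0 ≤ A := jacobiEnergy_nonneg a b L p (π / 4)
  have hLL : 0 < L ^ 2 := by positivity
  constructor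
  · have : |1 - π / 2 * (A / L ^ 2)| = |L ^ 2 - π / 2 * A| / L ^ 2 := by
      rw [← abs_of_pos hLL, ← abs_div, abs_of_pos hLL]
      congr 1
      field_simp
    rw [this, div_le_iff₀ hLL]
    have e4 : |L ^ 2 - π / 2 * A| ≤ (K₁ + K₂) * A * L ^ (-1 / 2 : ℝ) := by
      rw [abs_le] at e1 e3 ⊢
      constructor <;> nlinarith
    refine e4.trans ?_
    calc (K₁ + K₂) * A * L ^ (-1 / 2 : ℝ) ≤ max (K₁ + K₂) K₁ * A * L ^ (-1 / 2 : ℝ) := by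
          gcongr; exact le_max_left _ _
      _ = _ := by field_simp
  · set Y := ∫ t in (0)..(π / 4), cos t / sin t * jacobiU a b p t ^ 2
    have e4 : |2 * Y - A / L ^ 2 * log L| ≤ K₁ * (A / L ^ 2) := by
      have : |2 * Y - A / L ^ 2 * log L| = |2 * L ^ 2 * Y - log L * A| / L ^ 2 := by
        rw [← abs_of_pos hLL, ← abs_div, abs_of_pos hLL]
        congr 1
        field_simp
      rw [this, div_le_iff₀ hLL]
      refine e2.trans (le_of_eq ?_)
      field_simp
    have e5 : K₁ * (A / L ^ 2) ≤ max (K₁ + K₂) K₁ * (A / L ^ 2) := by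
      gcongr; exact le_max_right _ _
    rw [j2, abs_le] at *
    constructor <;> linarith

/-! ### Asymptotics of the mass of a single polynomial. -/

/-- The error is proportional to `r` itself, so dividing by `r` gives `|1/r - c| ≤ ε` with no prior
bound on `r`; `r = 0` would give `1 ≤ 0`. -/
theorem tendsto_of_abs_one_sub_le {ι : Type*} {l : Filter ι} {r ε : ι → ℝ} {c : ℝ} (hc : c ≠ 0)
    (hε : Tendsto ε l (𝓝 0)) (hr : ∀ i, 0 ≤ r i)
    (h : ∀ᶠ i in l, |1 - c * r i| ≤ r i * ε i) : Tendsto r l (𝓝 c⁻¹) := by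
  have h1 : Tendsto (fun i => (r i)⁻¹) l (𝓝 c) := by
    rw [tendsto_iff_norm_sub_tendsto_zero]
    refine squeeze_zero' (.of_forall fun _ => norm_nonneg _) ?_ hε
    filter_upwards [h] with i hi
    have hr0 : r i ≠ 0 := by
      intro h0
      rw [h0] at hi
      norm_num at hi
    have hr1 : 0 < r i := lt_of_le_of_ne (hr i) hr0.symm
    have : (r i)⁻¹ - c = (1 - c * r i) / r i := by field_simp
    rw [this, norm_eq_abs, abs_div, abs_of_pos hr1, div_le_iff₀ hr1]
    linarith
  simpa using h1.inv₀ hc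

theorem tendsto_log_natCast_atTop : Tendsto (fun n : ℕ => log n) atTop atTop :=
  tendsto_log_atTop.comp tendsto_natCast_atTop_atTop

theorem isLittleO_one_log_natCast :
    (fun _ : ℕ => (1 : ℝ)) =o[atTop] fun n : ℕ => log n :=
  isLittleO_const_left.2 (Or.inr (tendsto_norm_atTop_atTop.comp tendsto_log_natCast_atTop))

/-- The mass of the squared `n`-th orthonormal Jacobi polynomial against the shifted weight
grows like `2 / π * log n`. -/
theorem jacobiInner_jacobiP_shift_sub_isLittleO {a b : ℝ} (ha : 0 ≤ a) (hb : -1 / 2 ≤ b) :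
    (fun n : ℕ => jacobiInner (a - 1 / 2) (b + 1 / 2) (jacobiP a b n) (jacobiP a b n) -
      2 / π * log n) =o[atTop] fun n : ℕ => log n := by
  obtain ⟨K, hK⟩ := exists_jacobiInner_shift_estimate ha hb
  set L : ℕ → ℝ := fun n => 2 * (n : ℝ) + a + b + 1 with hLdef
  set r : ℕ → ℝ := fun n => jacobiEnergy a b (L n) (jacobiP a b n) (π / 4) / L n ^ 2 with hr
  set d : ℕ → ℝ := fun n => jacobiInner (a - 1 / 2) (b + 1 / 2) (jacobiP a b n) (jacobiP a b n)
  have hL1 : ∀ n ≥ 1, 1 ≤ L n := by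
    intro n hn
    have : (1 : ℝ) ≤ n := by exact_mod_cast hn
    simp only [hLdef]; linarith
  have hnorm : ∀ n, jacobiInner a b (jacobiP a b n) (jacobiP a b n) = 1 := fun n => by
    have := jacobiP_orthonormal (a := a) (b := b) (by linarith) (by linarith) n n
    rwa [if_pos rfl] at this
  have hKn := fun (n : ℕ) (hn : n ≥ 1) => hK n (L n) (jacobiP a b n) rfl
    (jacobiODE_jacobiP (by linarith) (by linarith) n) (hnorm n) n.cast_nonneg (hL1 n hn)
  have hLt : Tendsto L atTop atTop := by
    have h1 : Tendsto (fun n : ℕ => 2 * (n : ℝ)) atTop atTop :=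
      tendsto_natCast_atTop_atTop.const_mul_atTop two_pos
    refine (tendsto_atTop_add_const_right _ (a + b + 1) h1).congr fun n => ?_
    simp only [hLdef]; ring
  have hr0 : ∀ n, 0 ≤ r n := fun n => div_nonneg (jacobiEnergy_nonneg _ _ _ _ _) (sq_nonneg _)
  have hrt : Tendsto r atTop (𝓝 (π / 2)⁻¹) := by
    refine tendsto_of_abs_one_sub_le (ε := fun n => K * L n ^ (-(1 / 2) : ℝ)) (by positivity)
      ?_ hr0 ?_
    · simpa using ((tendsto_rpow_neg_atTop (y := 1 / 2) (by norm_num)).comp hLt).const_mul K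
    · filter_upwards [eventually_ge_atTop 1] with n hn
      refine (hKn n hn).1.trans (le_of_eq ?_)
      rw [show (-(1 / 2) : ℝ) = -1 / 2 by norm_num]
      simp only [hr]
      ring
  rw [inv_div] at hrt
  -- The difference splits as `(d - r log L) + r (log L - log n) + (r - 2/π) log n`. The first two
  -- terms are bounded, the second because `L/n → 2`; the third uses `r → 2/π`.
  have p1 : (fun n => d n - r n * log (L n)) =o[atTop] fun n : ℕ => log n := by
    refine IsBigO.trans_isLittleO ?_ isLittleO_one_log_natCast
    have hb1 : Tendsto (fun n => K * r n + 1) atTop (𝓝 (K * (2 / π) + 1)) :=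
      (hrt.const_mul K).add_const 1
    refine IsBigO.trans (IsBigO.of_bound 1 ?_) (hb1.isBigO_one ℝ)
    filter_upwards [eventually_ge_atTop 1] with n hn
    rw [one_mul, norm_eq_abs, norm_eq_abs]
    exact (hKn n hn).2.trans (le_abs_self _)
  have p2 : (fun n : ℕ => r n * (log (L n) - log n)) =o[atTop] fun n : ℕ => log n := by
    refine IsBigO.trans_isLittleO ?_ isLittleO_one_log_natCast
    have hq : Tendsto (fun n : ℕ => L n / n) atTop (𝓝 2) := by
      have h1 : Tendsto (fun n : ℕ => 2 + (a + b + 1) / (n : ℝ)) atTop (𝓝 (2 + 0)) :=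
        (tendsto_const_div_atTop_nhds_zero_nat (a + b + 1)).const_add 2
      rw [add_zero] at h1
      refine h1.congr' ?_
      filter_upwards [eventually_ge_atTop 1] with n hn
      have : (n : ℝ) ≠ 0 := by positivity
      simp only [hLdef]
      field_simp
      ring
    have hq2 : Tendsto (fun n : ℕ => log (L n) - log n) atTop (𝓝 (log 2)) := by
      refine (hq.log two_ne_zero).congr' ?_
      filter_upwards [eventually_ge_atTop 1] with n hn
      rw [log_div (by linarith [hL1 n hn]) (by positivity)]
    exact (hrt.mul hq2).isBigO_one ℝ
  have p3 : (fun n : ℕ => (r n - 2 / π) * log n) =o[atTop] fun n : ℕ => log n := by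
    have h0 : (fun n => r n - 2 / π) =o[atTop] fun _ : ℕ => (1 : ℝ) := by
      rw [isLittleO_one_iff]
      simpa using hrt.sub_const (2 / π)
    simpa using h0.mul_isBigO (isBigO_refl (fun n : ℕ => log n) atTop)
  refine ((p1.add p2).add p3).congr_left fun n => ?_
  ring

/-! ### Summation over the degree, and the kernel. -/

theorem tendsto_natCast_mul_log_atTop : Tendsto (fun n : ℕ => (n : ℝ) * log n) atTop atTop :=
  tendsto_natCast_atTop_atTop.atTop_mul_atTop₀ tendsto_log_natCast_atTop

theorem abs_succ_mul_log_sub_le {n : ℕ} (hn : 1 ≤ n) :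
    |((n + 1 : ℕ) : ℝ) * log (n + 1 : ℕ) - n * log n - log n| ≤ 2 := by
  have h1 : (1 : ℝ) ≤ n := by exact_mod_cast hn
  have h2 : 0 ≤ log (n + 1 : ℕ) - log n := by
    rw [sub_nonneg]
    exact log_le_log (by linarith) (by push_cast; linarith)
  have h3 : log (n + 1 : ℕ) - log n ≤ 1 / n := by
    rw [← log_div (by positivity) (by linarith)]
    refine (log_le_sub_one_of_pos (by positivity)).trans (le_of_eq ?_)
    push_cast
    field_simp
    ring
  have h4 : ((n + 1 : ℕ) : ℝ) * log (n + 1 : ℕ) - n * log n - log n =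
      (n + 1) * (log (n + 1 : ℕ) - log n) := by push_cast; ring
  rw [h4, abs_of_nonneg (by positivity)]
  calc ((n : ℝ) + 1) * (log (n + 1 : ℕ) - log n) ≤ (n + 1) * (1 / n) := by gcongr
    _ ≤ 2 := by rw [mul_one_div, div_le_iff₀ (by linarith)]; linarith

/-- Summing `d n = c * log n + o (log n)` gives `c * N * log N`. -/
theorem isEquivalent_sum_range_of_isLittleO_log {d : ℕ → ℝ} {c : ℝ} (hc : c ≠ 0)
    (h : (fun n : ℕ => d n - c * log n) =o[atTop] fun n : ℕ => log n) :
    (fun N => ∑ n ∈ Finset.range N, d n) ~[atTop] fun N : ℕ => c * N * log N := by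
  -- The increments of `n log n` are nonnegative, equivalent to `log n`, and telescope to `N log N`;
  -- comparing `d` with `c g` lets the little-o be summed.
  set g : ℕ → ℝ := fun n => ((n + 1 : ℕ) : ℝ) * log (n + 1 : ℕ) - n * log n with hg
  have hsum : ∀ N, ∑ n ∈ Finset.range N, g n = N * log N := fun N => by
    rw [hg, Finset.sum_range_sub (fun n : ℕ => (n : ℝ) * log n)]
    simp
  have hg0 : 0 ≤ g := by
    intro n
    simp only [hg, Pi.zero_apply, sub_nonneg]
    rcases Nat.eq_zero_or_pos n with rfl | hn
    · simp
    · have : (1 : ℝ) ≤ n := by exact_mod_cast hn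
      have h0 : 0 ≤ log (n : ℝ) := log_nonneg this
      gcongr <;> simp
  have hgl : (fun n : ℕ => g n - log n) =o[atTop] fun n : ℕ => log n := by
    refine IsBigO.trans_isLittleO (IsBigO.of_bound 2 ?_) isLittleO_one_log_natCast
    filter_upwards [eventually_ge_atTop 1] with n hn
    rw [norm_one, mul_one, norm_eq_abs]
    exact abs_succ_mul_log_sub_le hn
  have hequiv : g ~[atTop] fun n : ℕ => log n := hgl
  have hdg : (fun n => d n - c * g n) =o[atTop] g := by
    refine IsLittleO.trans_isBigO ?_ hequiv.symm.isBigO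
    refine (h.sub (hgl.const_mul_left c)).congr_left fun n => ?_
    ring
  have hfin := hdg.sum_range hg0 (by simpa only [hsum] using tendsto_natCast_mul_log_atTop)
  simp only [hsum, Finset.sum_sub_distrib, ← Finset.mul_sum] at hfin
  rw [IsEquivalent]
  have := hfin.const_mul_right hc (c := c)
  refine (this.congr_left fun N => ?_).congr_right fun N => ?_
  · simp only [Pi.sub_apply]; ring
  · ring

theorem isLittleO_log_comp_succ {d : ℕ → ℝ} {c : ℝ}
    (h : (fun n : ℕ => d n - c * log n) =o[atTop] fun n : ℕ => log n) :
    (fun n : ℕ => d (n + 1) - c * log n) =o[atTop] fun n : ℕ => log n := by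
  have hl : (fun n : ℕ => log ((n + 1 : ℕ) : ℝ) - log n) =o[atTop] fun n : ℕ => log n := by
    refine IsBigO.trans_isLittleO ?_ isLittleO_one_log_natCast
    have : Tendsto (fun n : ℕ => log ((n + 1 : ℕ) : ℝ) - log n) atTop (𝓝 0) := by
      simpa using tendsto_log_nat_add_one_sub_log
    exact this.isBigO_one ℝ
  have heq : (fun n : ℕ => log ((n + 1 : ℕ) : ℝ)) ~[atTop] fun n : ℕ => log n := hl
  have h1 := (h.comp_tendsto (tendsto_add_atTop_nat 1)).trans_isBigO heq.isBigO
  refine (h1.add (hl.const_mul_left c)).congr_left fun n => ?_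
  simp only [Function.comp_apply]
  ring

/-- The open interval matters: at `x = 0` the convention `0 ^ (-1/2) = 0` breaks the merging of
powers, for instance when `a = 1/2`. -/
theorem shifted_jacobiKernel_diag (a b : ℝ) (s : Finset ℕ) {x : ℝ} (hx : x ∈ Set.Ioo (0 : ℝ) 1) :
    x ^ (-1 / 2 : ℝ) * (1 - x) ^ (1 / 2 : ℝ) * jacobiKernel a b s x x =
      ∑ j ∈ s, (jacobiP a b j).eval x * (jacobiP a b j).eval x *
        jacobiWeight (a - 1 / 2) (b + 1 / 2) x := by
  have h0 := hx.1
  have h1 : 0 < 1 - x := sub_pos.2 hx.2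
  have hw : 0 ≤ jacobiWeight a b x := by rw [jacobiWeight]; positivity
  have e : jacobiWeight (a - 1 / 2) (b + 1 / 2) x =
      x ^ (-1 / 2 : ℝ) * (1 - x) ^ (1 / 2 : ℝ) * jacobiWeight a b x := by
    rw [jacobiWeight, jacobiWeight, show a - 1 / 2 = -1 / 2 + a by ring,
      show b + 1 / 2 = 1 / 2 + b by ring, rpow_add h0, rpow_add h1]
    ring
  rw [jacobiKernel, sqrt_mul_self hw, e, ← Finset.sum_mul]
  ring

theorem integral_shifted_jacobiKernel {a b : ℝ} (ha : -1 / 2 < a) (hb : -1 < b) (s : Finset ℕ) :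
    IntervalIntegrable (fun x : ℝ => x ^ (-1 / 2 : ℝ) * (1 - x) ^ (1 / 2 : ℝ) *
        jacobiKernel a b s x x) MeasureTheory.volume 0 1 ∧
      ∫ x in (0 : ℝ)..1, x ^ (-1 / 2 : ℝ) * (1 - x) ^ (1 / 2 : ℝ) * jacobiKernel a b s x x =
        ∑ j ∈ s, jacobiInner (a - 1 / 2) (b + 1 / 2) (jacobiP a b j) (jacobiP a b j) := by
  have hi : ∀ j ∈ s, IntervalIntegrable (fun x => (jacobiP a b j).eval x * (jacobiP a b j).eval x *
      jacobiWeight (a - 1 / 2) (b + 1 / 2) x) MeasureTheory.volume 0 1 := fun j _ =>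
    intervalIntegrable_eval_mul_jacobiWeight (by linarith) (by linarith) _ _
  have hk : Set.EqOn _ _ (Set.Ioo (0 : ℝ) 1) := fun x hx => shifted_jacobiKernel_diag a b s hx
  constructor
  · have := IntervalIntegrable.sum s hi
    rw [intervalIntegrable_iff_integrableOn_Ioo_of_le zero_le_one] at this ⊢
    refine (MeasureTheory.integrableOn_congr_fun (fun x hx => ?_) measurableSet_Ioo).2 this
    rw [hk hx, Finset.sum_apply]
  · simp only [jacobiInner]
    rw [← intervalIntegral.integral_finsetSum hi, intervalIntegral.integral_of_le zero_le_one,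
      intervalIntegral.integral_of_le zero_le_one, MeasureTheory.integral_Ioc_eq_integral_Ioo,
      MeasureTheory.integral_Ioc_eq_integral_Ioo]
    exact MeasureTheory.setIntegral_congr_fun measurableSet_Ioo hk

theorem mainTheorem5 (a b : ℝ) (hab : b ≤ a) (hb : -1 / 2 ≤ b) (ha : 0 ≤ a) :
    -- the kernel with degrees `0, …, N - 1`
    ((∀ N : ℕ, IntervalIntegrable
        (fun x : ℝ => x ^ (-1 / 2 : ℝ) * (1 - x) ^ (1 / 2 : ℝ) *
          jacobiKernel a b (Finset.range N) x x) MeasureTheory.volume 0 1) ∧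
      Asymptotics.IsEquivalent Filter.atTop
        (fun N : ℕ => ∫ x in (0 : ℝ)..1, x ^ (-1 / 2 : ℝ) * (1 - x) ^ (1 / 2 : ℝ) *
          jacobiKernel a b (Finset.range N) x x)
        (fun N : ℕ => 2 / Real.pi * N * Real.log N)) ∧
    -- the kernel with degrees `1, …, N`
    ((∀ N : ℕ, IntervalIntegrable
        (fun x : ℝ => x ^ (-1 / 2 : ℝ) * (1 - x) ^ (1 / 2 : ℝ) *
          jacobiKernel a b (Finset.Icc 1 N) x x) MeasureTheory.volume 0 1) ∧
      Asymptotics.IsEquivalent Filter.atTop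
        (fun N : ℕ => ∫ x in (0 : ℝ)..1, x ^ (-1 / 2 : ℝ) * (1 - x) ^ (1 / 2 : ℝ) *
          jacobiKernel a b (Finset.Icc 1 N) x x)
        (fun N : ℕ => 2 / Real.pi * N * Real.log N)) := by
  have hk := integral_shifted_jacobiKernel (a := a) (b := b) (by linarith) (by linarith)
  have hd := jacobiInner_jacobiP_shift_sub_isLittleO ha hb
  have hc : (2 / π : ℝ) ≠ 0 := by positivity
  refine ⟨⟨fun N => (hk _).1, ?_⟩, fun N => (hk _).1, ?_⟩
  · simp only [(hk _).2]
    exact isEquivalent_sum_range_of_isLittleO_log hc hd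
  -- Degrees `1, …, N` become `1 + k` with `k < N`; shifting the index changes `log n` by `o(log n)`
  -- only.
  · simp only [(hk _).2, ← Finset.Ico_add_one_right_eq_Icc, Finset.sum_Ico_eq_sum_range,
      Nat.add_sub_cancel]
    simpa only [add_comm 1] using
      isEquivalent_sum_range_of_isLittleO_log hc (isLittleO_log_comp_succ hd)
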